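/- **Setting.** Let $C\ge 3/2$ be a constant and let $G=(V,E)$ be an unweighted, strongly connected directed graph with $V=\{0,\dots,n-1\}$, $n\ge 1$. Let $d(s,t)$ be the distance in $G$ and, for a failing edge or vertex $f\in E\cup V$, let $d(s,t,f)\in\mathbb N\cup\{\infty\}$ be the distance in $G-f$ (it is $\infty$ if $f\in\{s,t\}$); a shortest $s$-$t$-path in $G-f$ is called a replacement path for $(s,t,f)$. *APSP data* give, for all $s,t\in V$, the distance $d(s,t)$ and a fixed shortest path $P(s,t)$. A *deterministic path-reporting DSO with $O(1)$ query time* is an oracle that, for $s,t\in V$ and $f\in E\cup V$, returns $d(s,t,f)$ in time $O(1)$ and, if this is finite, on request a fixed replacement path $P(s,t,f)$ in time $O(1)$ per reported vertex. **The HDPH algorithm.** Set $B_0=B_1=B_2=V$. For $i=3,\dots,\lceil\log_C n\rceil$ let $X=B_{i-3}\cup B_{i-2}\cup B_{i-1}$ and let $\mathcal P_i$ be the collection of the following paths, each listed under its label $(x,y)$ or $(x,y,f)$: * $P(x,y)$ for all $x,y\in X$ with $d(x,y)\in(C^{i-6},C^{i+1}]$; * $P(x,y,f)$ for all $x,y\in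 X$ with $d(x,y)\le C^{i+1}$ and all edges or vertices $f$ on $P(x,y)$ with $d(x,y,f)\in(C^{i-6},C^{i+1}]$. Then $B_i$ is the result of the greedy hitting set procedure on $\mathcal P_i$: as long as some path of $\mathcal P_i$ contains no selected vertex, select a vertex contained in the largest number of such paths, ties being broken arbitrarily. The output is $B_0,\dots,B_{\lceil\log_C n\rceil}$. **Statement.** $\widetilde O(g)$ stands for a bound $K\,g\,\log^{k}(n+2)$ with constants $K,k$ that depend only on $C$. 1. The HDPH algorithm can be implemented deterministically in time $\widetilde O(n^2)$: there is a single program for a deterministic RAM with words of $O(\log n)$ bits (and real registers for multiplying, dividing and comparing with words, in which $C$ is given; all memory is initially zero) that, given $n$, $C$ and query access to the APSP data and the DSO (unit cost per distance and per reported path vertex), halts after $\widetilde O(n^2)$ steps and outputs sets $B_0,\dots,B_{\lceil\log_C n\rceil}$ of a run of the HDPH algorithm. 2. For every run of the HDPH algorithm and every $0\le i\le\lceil\log_C n\rceil$: * $|B_i|=\widetilde O(n/C^i)$; * for all $s,t\in V$ and every $f\in E\cup V$ with $d(s,t,f)\in(C^i,C^{i+1}]$ there is $z\in B_i$ with $d(s,t,f)=d(s,z,f)+d(z,t,f)$;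 * for all $s,t\in V$ with $d(s,t)\in(C^i,C^{i+1}]$ there is $z\in B_i$ with $d(s,t)=d(s,z)+d(z,t)$. -/

import Mathlib

namespace HDPH

/-! ### Failures, walks and (replacement) distances in unweighted digraphs -/

/-- A single failure: `Sum.inl v` is the vertex `v`, `Sum.inr (u, v)` is the edge `(u, v)`. -/
abbrev Failure (V : Type*) := V ⊕ (V × V)

/-- `f ∈ E ∪ V`. -/
def Failure.IsIn {V : Type*} (G : Digraph V) : Failure V → Prop
  | Sum.inl _ => True
  | Sum.inr e => G.Adj e.1 e.2

/-- `p` is the vertex sequence of a walk from `s` to `t` in `G - F`, where `F = none` means that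
nothing fails. A failing vertex is removed together with its incident edges. -/
def IsWalk {V : Type*} (G : Digraph V) (F : Option (Failure V)) (s t : V) (p : List V) : Prop :=
  p.head? = some s ∧ p.getLast? = some t ∧
  (∀ v ∈ p, F ≠ some (Sum.inl v)) ∧
  p.IsChain (fun u v => G.Adj u v ∧ F ≠ some (Sum.inr (u, v)))

/-- The number of edges of a walk given by its vertex sequence. -/
def walkLength {V : Type*} (p : List V) : ℕ := p.length - 1

/-- `dist G none s t` is the distance `d(s,t)` in `G`, and `dist G (some f) s t` is the replacement
distance `d(s,t,f)`, that is, the distance in `G - f`. It is `⊤` if there is no such walk, in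
particular if the failing vertex is `s` or `t`. -/
noncomputable def dist {V : Type*} (G : Digraph V) (F : Option (Failure V)) (s t : V) : ℕ∞ :=
  ⨅ p ∈ {p : List V | IsWalk G F s t p}, (walkLength p : ℕ∞)

/-- A shortest path from `s` to `t` in `G - F`; if `F = some f`, a replacement path `P(s,t,f)`. -/
def IsShortestPath {V : Type*} (G : Digraph V) (F : Option (Failure V)) (s t : V)
    (p : List V) : Prop :=
  IsWalk G F s t p ∧ (walkLength p : ℕ∞) = dist G F s t

def StronglyConnected {V : Type*} (G : Digraph V) : Prop :=
  ∀ s t, Relation.ReflTransGen G.Adj s t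

/-- APSP data: a shortest path `P(s,t)` for each pair. The distances come with it, see `Exec`. -/
structure APSPData {V : Type*} (G : Digraph V) where
  path : V → V → List V
  isShortestPath : ∀ s t, dist G none s t ≠ ⊤ → IsShortestPath G none s t (path s t)

/-- A path-reporting (exact, single-failure) distance sensitivity oracle: it answers a query
`(s,t,f)` with the replacement distance and, on request, with a replacement path, which is
determined by the query. The distances come with it, see `Exec`. -/
structure DSO {V : Type*} (G : Digraph V) where
  path : V → V → Failure V → List V
  isShortestPath : ∀ s t f, f.IsIn G → dist G (some f) s t ≠ ⊤ →
    IsShortestPath G (some f) s t (path s t f)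

/-- The path reported for `(s,t)` by the APSP data, or for `(s,t,f)` by the DSO. -/
def reported {V : Type*} {G : Digraph V} (A : APSPData G) (D : DSO G) (s t : V) :
    Option (Failure V) → List V
  | none => A.path s t
  | some f => D.path s t f

/-! ### The HDPH algorithm -/

/-- `d ∈ (a, b]`. -/
def InRange (d : ℕ∞) (a b : ℝ) : Prop := ∃ k : ℕ, d = k ∧ a < k ∧ (k : ℝ) ≤ b

/-- `f ∈ E(p) ∪ V(p)`. -/
def Failure.OnPath {V : Type*} (p : List V) : Failure V → Prop
  | Sum.inl v => v ∈ p
  | Sum.inr e => [e.1, e.2] <:+: p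

/-- `ceilLog C n` is `⌈log_C n⌉`. -/
noncomputable def ceilLog (C : ℝ) (n : ℕ) : ℕ := ⌈Real.logb C n⌉₊

/-- The path `P(x,y)` (case `none`) or `P(x,y,f)` (case `some f`) is put into the collection
`𝒫ᵢ`, where `X` is the set of pivots of the three previous stages. -/
def IsCritical {V : Type*} {G : Digraph V} (C : ℝ) (A : APSPData G) (X : Finset V) (i : ℕ)
    (x y : V) : Option (Failure V) → Prop
  | none => x ∈ X ∧ y ∈ X ∧ InRange (dist G none x y) (C ^ ((i : ℤ) - 6)) (C ^ (i + 1))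
  | some f => x ∈ X ∧ y ∈ X ∧
      (∃ k : ℕ, dist G none x y = k ∧ (k : ℝ) ≤ C ^ (i + 1)) ∧
      f.OnPath (A.path x y) ∧
      InRange (dist G (some f) x y) (C ^ ((i : ℤ) - 6)) (C ^ (i + 1))

open Classical in
/-- The collection `𝒫ᵢ`, each path being listed under the query that reports it. -/
noncomputable def critical {V : Type*} [Fintype V] {G : Digraph V} (C : ℝ) (A : APSPData G)
    (X : Finset V) (i : ℕ) : Finset (V × V × Option (Failure V)) :=
  Finset.univ.filter fun q => IsCritical C A X i q.1 q.2.1 q.2.2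

open Classical in
/-- `GreedyRun path S B`: a run of `GreedyPivotSelection` on the paths `path q`, `q ∈ S`, returns
`B`. As long as some path is unhit, a vertex contained in the most unhit paths is selected; ties
are broken arbitrarily. -/
inductive GreedyRun {V ι : Type*} (path : ι → List V) : Finset ι → Finset V → Prop
  | done : GreedyRun path ∅ ∅
  | pick (S : Finset ι) (v : V) (B : Finset V) :
      S.Nonempty →
      (∀ u : V, (S.filter fun q => u ∈ path q).card ≤ (S.filter fun q => v ∈ path q).card) →
      GreedyRun path (S.filter fun q => v ∉ path q) B →
      GreedyRun path S (insert v B)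

open Classical in
/-- The sets `B 0, …, B ⌈log_C n⌉` are those of a run of the HDPH algorithm. -/
structure IsHDPHRun {V : Type*} [Fintype V] {G : Digraph V} (C : ℝ) (A : APSPData G) (D : DSO G)
    (B : ℕ → Finset V) : Prop where
  init : ∀ i ≤ 2, B i = Finset.univ
  step : ∀ i, 3 ≤ i → i ≤ ceilLog C (Fintype.card V) →
    GreedyRun (fun q : V × V × Option (Failure V) => reported A D q.1 q.2.1 q.2.2)
      (critical C A (B (i - 3) ∪ B (i - 2) ∪ B (i - 1)) i) (B i)

/-! ### The machine model

A deterministic RAM, programmed in a structured language: word registers, arrays of words (each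
cell addressed by two words) and real registers, the latter only for multiplication, division and
comparison with words. The APSP data and the DSO are accessible through queries only. -/

structure State where
  reg : ℕ → ℕ
  mem : ℕ → ℕ → ℕ → ℕ
  real : ℕ → ℝ

inductive Expr
  | const (k : ℕ)
  | reg (r : ℕ)
  | load (a : ℕ) (i j : Expr)
  | add (e₁ e₂ : Expr)
  | sub (e₁ e₂ : Expr)
  | mul (e₁ e₂ : Expr)
  | div (e₁ e₂ : Expr)

def Expr.eval (σ : State) : Expr → ℕ
  | const k => k
  | reg r => σ.reg r
  | load a i j => σ.mem a (i.eval σ) (j.eval σ)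
  | add e₁ e₂ => e₁.eval σ + e₂.eval σ
  | sub e₁ e₂ => e₁.eval σ - e₂.eval σ
  | mul e₁ e₂ => e₁.eval σ * e₂.eval σ
  | div e₁ e₂ => e₁.eval σ / e₂.eval σ

inductive Cond
  | le (e₁ e₂ : Expr)
  | leReal (e : Expr) (r : ℕ)
  | not (c : Cond)
  | and (c₁ c₂ : Cond)

def Cond.Holds (σ : State) : Cond → Prop
  | le e₁ e₂ => e₁.eval σ ≤ e₂.eval σ
  | leReal e r => (e.eval σ : ℝ) ≤ σ.real r
  | not c => ¬ c.Holds σ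
  | and c₁ c₂ => c₁.Holds σ ∧ c₂.Holds σ

/-- Programs. The queries with `F = none` address the APSP data, the others the DSO. -/
inductive Cmd
  | skip
  | assign (r : ℕ) (e : Expr)
  | store (a : ℕ) (i j e : Expr)
  | realCast (r : ℕ) (e : Expr)
  | realMul (r r₁ r₂ : ℕ)
  | realDiv (r r₁ r₂ : ℕ)
  | queryDist (r : ℕ) (x y : Expr) (F : Option (Failure Expr))
  | queryPath (a : ℕ) (i x y : Expr) (F : Option (Failure Expr))
  | seq (c₁ c₂ : Cmd)
  | ite (b : Cond) (c₁ c₂ : Cmd)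
  | loop (b : Cond) (c : Cmd)

def State.setReg (σ : State) (r v : ℕ) : State :=
  { σ with reg := Function.update σ.reg r v }

def State.setMem (σ : State) (a i j v : ℕ) : State :=
  { σ with mem := fun a' i' j' => if a' = a ∧ i' = i ∧ j' = j then v else σ.mem a' i' j' }

noncomputable def State.setReal (σ : State) (r : ℕ) (v : ℝ) : State :=
  { σ with real := Function.update σ.real r v }

/-- Write the list `p` into the first cells of row `i` of the array `a`. -/
def State.setRow (σ : State) (a i : ℕ) (p : List ℕ) : State :=
  { σ with mem := fun a' i' j' =>
      if a' = a ∧ i' = i then p.getD j' (σ.mem a' i' j') else σ.mem a' i' j' }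

/-- The word that represents a distance in an `n`-vertex graph; `n` stands for `⊤` (a finite
distance is at most `n - 1`). -/
def distWord (n : ℕ) : ℕ∞ → ℕ
  | none => n
  | some k => k

/-- Replace all the entries of an optional failure. -/
def mapFailure {α β : Type*} (g : α → β) (F : Option (Failure α)) : Option (Failure β) :=
  F.map (Sum.map g (Prod.map g g))

/-- `Exec A D W c σ σ' t`: started in `σ`, the program `c` halts in `σ'` after `t` steps, all words
being less than `W`. Instructions and tests take one step each (the expressions in a program have
constant size), except that a path query takes one step and one more for each reported vertex.
There is no rule, so the machine is stuck, if a word overflows, if a query is not about vertices of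
`G` and a failure in `E ∪ V`, or if a path that does not exist is requested. -/
inductive Exec {n : ℕ} {G : Digraph (Fin n)} (A : APSPData G) (D : DSO G) (W : ℕ) :
    Cmd → State → State → ℕ → Prop
  | skip (σ : State) : Exec A D W Cmd.skip σ σ 1
  | assign (σ : State) (r : ℕ) (e : Expr) :
      e.eval σ < W → Exec A D W (Cmd.assign r e) σ (σ.setReg r (e.eval σ)) 1
  | store (σ : State) (a : ℕ) (i j e : Expr) :
      i.eval σ < W → j.eval σ < W → e.eval σ < W →
      Exec A D W (Cmd.store a i j e) σ (σ.setMem a (i.eval σ) (j.eval σ) (e.eval σ)) 1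
  | realCast (σ : State) (r : ℕ) (e : Expr) :
      e.eval σ < W → Exec A D W (Cmd.realCast r e) σ (σ.setReal r (e.eval σ)) 1
  | realMul (σ : State) (r r₁ r₂ : ℕ) :
      Exec A D W (Cmd.realMul r r₁ r₂) σ (σ.setReal r (σ.real r₁ * σ.real r₂)) 1
  | realDiv (σ : State) (r r₁ r₂ : ℕ) :
      Exec A D W (Cmd.realDiv r r₁ r₂) σ (σ.setReal r (σ.real r₁ / σ.real r₂)) 1
  | queryDist (σ : State) (r : ℕ) (ex ey : Expr) (eF : Option (Failure Expr))
      (x y : Fin n) (F : Option (Failure (Fin n))) :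
      ex.eval σ = x → ey.eval σ = y →
      mapFailure (fun e => e.eval σ) eF = mapFailure Fin.val F → (∀ f ∈ F, f.IsIn G) →
      distWord n (dist G F x y) < W →
      Exec A D W (Cmd.queryDist r ex ey eF) σ (σ.setReg r (distWord n (dist G F x y))) 1
  | queryPath (σ : State) (a : ℕ) (i ex ey : Expr) (eF : Option (Failure Expr))
      (x y : Fin n) (F : Option (Failure (Fin n))) :
      i.eval σ < W → n ≤ W → ex.eval σ = x → ey.eval σ = y →
      mapFailure (fun e => e.eval σ) eF = mapFailure Fin.val F → (∀ f ∈ F, f.IsIn G) →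
      dist G F x y ≠ ⊤ →
      Exec A D W (Cmd.queryPath a i ex ey eF) σ
        (σ.setRow a (i.eval σ) ((reported A D x y F).map Fin.val))
        (1 + (reported A D x y F).length)
  | seq (c₁ c₂ : Cmd) (σ₁ σ₂ σ₃ : State) (t₁ t₂ : ℕ) :
      Exec A D W c₁ σ₁ σ₂ t₁ → Exec A D W c₂ σ₂ σ₃ t₂ →
      Exec A D W (Cmd.seq c₁ c₂) σ₁ σ₃ (t₁ + t₂)
  | iteTrue (b : Cond) (c₁ c₂ : Cmd) (σ σ' : State) (t : ℕ) :
      b.Holds σ → Exec A D W c₁ σ σ' t → Exec A D W (Cmd.ite b c₁ c₂) σ σ' (1 + t)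
  | iteFalse (b : Cond) (c₁ c₂ : Cmd) (σ σ' : State) (t : ℕ) :
      ¬ b.Holds σ → Exec A D W c₂ σ σ' t → Exec A D W (Cmd.ite b c₁ c₂) σ σ' (1 + t)
  | loopTrue (b : Cond) (c : Cmd) (σ₁ σ₂ σ₃ : State) (t₁ t₂ : ℕ) :
      b.Holds σ₁ → Exec A D W c σ₁ σ₂ t₁ → Exec A D W (Cmd.loop b c) σ₂ σ₃ t₂ →
      Exec A D W (Cmd.loop b c) σ₁ σ₃ (1 + t₁ + t₂)
  | loopFalse (b : Cond) (c : Cmd) (σ : State) :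
      ¬ b.Holds σ → Exec A D W (Cmd.loop b c) σ σ 1

/-- Initially, register `0` holds `n`, real register `0` holds `C`, and all else is `0`. -/
noncomputable def initial (C : ℝ) (n : ℕ) : State where
  reg := Function.update 0 0 n
  mem := 0
  real := Function.update 0 0 C

open Classical in
/-- The output `B 0, …, B ℓ` is found in array `0`, row `i` being the indicator vector of `B i`. -/
def Outputs {n : ℕ} (σ : State) (ℓ : ℕ) (B : ℕ → Finset (Fin n)) : Prop :=
  ∀ i ≤ ℓ, ∀ v : Fin n, σ.mem 0 i v = if v ∈ B i then 1 else 0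

end HDPH

/-!
The hitting property holds by strong induction on the stage (`IsHDPHRun.exists_pivot`). In a
shortest `s`-`t`-path of `G - F` with length in `(C ^ i, C ^ (i + 1)]`, cut off a prefix and a
suffix of length `⌊C ^ (i - 3)⌋ + 1`. This length is in the range of one of the three previous
stages, so there are recent pivots `x` and `y` on shortest paths that may replace the prefix and
the suffix, and what lies between them is long enough for stage `i`. If the failure is not on
`P(x,y)`, then `P(x,y)` is a shortest path in `G - F`, otherwise the replacement path is in the
collection; in both cases a selected vertex lies on it (`exists_hit_of_recent`). Cutting off is
needed for `i ≥ 6` only, since for `i ≤ 5` all vertices are recent pivots (`recent_eq_univ`).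

All paths of stage `i` have more than `C ^ (i - 6)` vertices, hence each greedy selection hits a
fraction `C ^ (i - 6) / n` of the remaining paths and `O(n log n / C ^ i)` selections are enough
(`GreedyRun.card_le`, `IsHDPHRun.card_le`).

The program `hdph` goes through all pairs `x`, `y` in every stage, and for pairs of recent pivots
at distance at most `C ^ (i + 1)` it queries one replacement distance for each vertex and each
edge of `P(x,y)`. With `M = O(C ^ i)` vertices per path and `O(n log n / C ^ i)` recent pivots
this takes time `O(n ^ 2 log ^ 2 n)` (`runs_collect`, `stage_time_le`). Each vertex has a list of
the paths through it and the number of those which are unhit. A selection scans all these numbers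
for the largest and marks the paths in the list of the selected vertex as hit, so that the total
time is `O(n ^ 2)` plus the total length of the paths (`runs_greedy`). Paths are kept under the
number `code` of their label, which is polynomial in `n`.

The program is verified in a Hoare logic for total correctness, `Runs`, in which postconditions
and invariants also speak of the elapsed time. What a program does not write to is read off its
text (`Exec.frame`).
-/

namespace HDPH

/-! ### Walks and distances -/

section Walks

variable {V : Type*} {G : Digraph V} {F : Option (Failure V)} {s t u v : V} {p : List V}

theorem isWalk_append_cons {l₁ l₂ : List V} :
    IsWalk G F s t (l₁ ++ v :: l₂) ↔ IsWalk G F s v (l₁ ++ [v]) ∧ IsWalk G F v t (v :: l₂) := by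
  have hhead : (l₁ ++ v :: l₂).head? = (l₁ ++ [v]).head? := by cases l₁ <;> simp
  have hlast : (l₁ ++ v :: l₂).getLast? = (v :: l₂).getLast? := by
    rw [List.getLast?_append]; simp [List.getLast?_cons]
  unfold IsWalk
  rw [hhead, hlast, List.isChain_split]
  simp only [List.mem_append, List.mem_cons, List.head?_cons, List.getLast?_append,
    List.getLast?_singleton, Option.some_or, List.not_mem_nil, or_false]
  constructor
  · rintro ⟨h1, h2, h3, h4, h5⟩
    exact ⟨⟨h1, trivial, fun w hw => h3 w (by tauto), h4⟩, trivial, h2,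
      fun w hw => h3 w (by tauto), h5⟩
  · rintro ⟨⟨h1, -, h3, h4⟩, -, h2, h3', h5⟩
    exact ⟨h1, h2, fun w hw => by
      rcases hw with hw | hw
      exacts [h3 w (.inl hw), h3' w hw], h4, h5⟩

theorem IsWalk.exists_eq_append_singleton (h : IsWalk G F s t p) : ∃ l, p = l ++ [t] := by
  have := h.2.1
  rw [List.getLast?_eq_some_iff] at this
  exact this

theorem IsWalk.exists_eq_cons (h : IsWalk G F s t p) : ∃ l, p = s :: l := by
  have := h.1
  rw [List.head?_eq_some_iff] at this
  exact this

theorem dist_le_of_isWalk (h : IsWalk G F s t p) : dist G F s t ≤ walkLength p :=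
  iInf₂_le (f := fun (p : List V) (_ : p ∈ {p | IsWalk G F s t p}) => (walkLength p : ℕ∞)) p h

theorem exists_isShortestPath (h : dist G F s t ≠ ⊤) : ∃ p, IsShortestPath G F s t p := by
  have hne : Nonempty {p : List V | IsWalk G F s t p} := by
    by_contra hempty
    apply h
    unfold dist
    rw [iInf_subtype']
    have := not_nonempty_iff.1 hempty
    exact iInf_of_empty _
  obtain ⟨⟨p, hp⟩, hpe⟩ := ENat.exists_eq_iInf
    (fun p : {p : List V | IsWalk G F s t p} => (walkLength p.1 : ℕ∞))
  refine ⟨p, hp, ?_⟩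
  unfold dist
  rw [iInf_subtype']
  exact hpe

theorem dist_triangle (s u t : V) : dist G F s t ≤ dist G F s u + dist G F u t := by
  by_cases h1 : dist G F s u = ⊤
  · simp [h1]
  by_cases h2 : dist G F u t = ⊤
  · simp [h2]
  obtain ⟨p, hp, hpl⟩ := exists_isShortestPath h1
  obtain ⟨q, hq, hql⟩ := exists_isShortestPath h2
  obtain ⟨l₁, rfl⟩ := hp.exists_eq_append_singleton
  obtain ⟨l₂, rfl⟩ := hq.exists_eq_cons
  refine (dist_le_of_isWalk (isWalk_append_cons.2 ⟨hp, hq⟩)).trans ?_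
  rw [← hpl, ← hql]
  simp [walkLength]

/-- A vertex on a shortest path splits it into two shortest paths. -/
theorem IsShortestPath.dist_split {l₁ l₂ : List V} (h : IsShortestPath G F s t (l₁ ++ v :: l₂)) :
    dist G F s v = l₁.length ∧ dist G F v t = l₂.length ∧
      dist G F s t = dist G F s v + dist G F v t := by
  obtain ⟨hw, hl⟩ := h
  obtain ⟨h1, h2⟩ := isWalk_append_cons.1 hw
  have h1 := dist_le_of_isWalk h1
  have h2 := dist_le_of_isWalk h2
  have h3 := dist_triangle (G := G) (F := F) s v t
  simp only [walkLength, List.length_append, List.length_cons, List.length_nil, zero_add,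
    Nat.add_sub_cancel] at h1 h2 hl
  rw [← hl] at h3
  lift dist G F s v to ℕ using ne_top_of_le_ne_top (ENat.natCast_ne_top _) h1 with a ha
  lift dist G F v t to ℕ using ne_top_of_le_ne_top (ENat.natCast_ne_top _) h2 with b hb
  rw [← hl]
  norm_cast at h1 h2 h3 ⊢
  omega

theorem IsShortestPath.dist_eq_add (h : IsShortestPath G F s t p) (hv : v ∈ p) :
    dist G F s t = dist G F s v + dist G F v t := by
  obtain ⟨l₁, l₂, rfl⟩ := List.append_of_mem hv
  exact h.dist_split.2.2

theorem IsShortestPath.nodup (h : IsShortestPath G F s t p) : p.Nodup := by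
  rw [List.nodup_iff_injective_getElem]
  have key : ∀ i : Fin p.length, dist G F s p[i] = (i : ℕ) := by
    intro i
    have hp : p = p.take i ++ p[i] :: p.drop (i + 1) := by simp
    have h' := h
    rw [hp] at h'
    have := h'.dist_split.1
    simpa [i.2.le] using this
  intro i j hij
  have hi := key i
  have hj := key j
  have : p[i] = p[j] := hij
  rw [this, hj] at hi
  exact Fin.ext (by exact_mod_cast hi.symm)

theorem IsShortestPath.length_eq {k : ℕ} (h : IsShortestPath G F s t p)
    (hk : dist G F s t = k) : p.length = k + 1 := by
  have h2 := h.2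
  obtain ⟨l, rfl⟩ := h.1.exists_eq_cons
  rw [hk] at h2
  simp only [walkLength, List.length_cons, Nat.add_sub_cancel] at h2 ⊢
  norm_cast at h2
  omega

theorem dist_lt_card [Fintype V] {k : ℕ} (hk : dist G F s t = k) : k < Fintype.card V := by
  obtain ⟨p, hp⟩ := exists_isShortestPath (G := G) (F := F) (s := s) (t := t) (by simp [hk])
  have := hp.nodup.length_le_card
  have := hp.length_eq hk
  omega

/-- Every length up to the distance is realised by a vertex on a shortest path. -/
theorem exists_dist_eq {k a : ℕ} (hk : dist G F s t = k) (ha : a ≤ k) :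
    ∃ v, dist G F s v = a ∧ dist G F v t = (k - a : ℕ) := by
  obtain ⟨p, hp⟩ := exists_isShortestPath (G := G) (F := F) (s := s) (t := t) (by simp [hk])
  have hlen := hp.length_eq hk
  have hlt : a < p.length := by omega
  have he : p = p.take a ++ p[a] :: p.drop (a + 1) := by simp
  rw [he] at hp
  refine ⟨p[a], ?_, ?_⟩
  · simpa [hlt.le] using hp.dist_split.1
  · rw [hp.dist_split.2.1, List.length_drop, hlen]
    norm_cast
    omega

theorem dist_none_le : dist G none s t ≤ dist G F s t := by
  by_cases h : dist G F s t = ⊤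
  · simp [h]
  obtain ⟨p, hp, hpl⟩ := exists_isShortestPath h
  rw [← hpl]
  exact dist_le_of_isWalk ⟨hp.1, hp.2.1, by simp, hp.2.2.2.imp fun _ _ h => ⟨h.1, by simp⟩⟩

theorem IsWalk.of_not_onPath {f : Failure V} (h : IsWalk G none s t p) (hf : ¬ f.OnPath p) :
    IsWalk G (some f) s t p := by
  refine ⟨h.1, h.2.1, ?_, ?_⟩
  · rintro v hv hfv
    obtain rfl : f = Sum.inl v := by simpa using hfv
    exact hf hv
  · have := h.2.2.2
    rw [List.isChain_iff_forall_rel_of_append_cons_cons] at this ⊢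
    intro a b l₁ l₂ he
    refine ⟨(this he).1, fun hfe => ?_⟩
    obtain rfl : f = Sum.inr (a, b) := by simpa using hfe
    exact hf ⟨l₁, l₂, by simp [he]⟩

theorem IsWalk.isIn_of_onPath {f : Failure V} (h : IsWalk G F s t p) (hf : f.OnPath p) :
    f.IsIn G := by
  rcases f with v | ⟨a, b⟩
  · trivial
  · have hc := h.2.2.2.infix (show [a, b] <:+: p from hf)
    simp only [List.isChain_cons_cons] at hc
    exact hc.1.1

/-- If the failure misses the reported shortest path, it is also a replacement path. -/
theorem IsShortestPath.of_not_onPath {f : Failure V} (h : IsShortestPath G none s t p)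
    (hf : ¬ f.OnPath p) : IsShortestPath G (some f) s t p := by
  have hw := h.1.of_not_onPath hf
  refine ⟨hw, le_antisymm ?_ (dist_le_of_isWalk hw)⟩
  rw [h.2]
  exact dist_none_le

theorem dist_self_of_ne_top {u : V} (h : dist G F s u ≠ ⊤) : dist G F s s = 0 ∧
    dist G F u u = 0 := by
  obtain ⟨p, hp, -⟩ := exists_isShortestPath h
  have aux : ∀ w ∈ p, dist G F w w = 0 := by
    intro w hw
    have : IsWalk G F w w [w] := ⟨rfl, rfl, by simpa using hp.2.2.1 w hw, by simp⟩
    simpa [walkLength] using dist_le_of_isWalk this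
  exact ⟨aux s (List.mem_of_mem_head? hp.1), aux u (List.mem_of_getLast? hp.2.1)⟩

theorem StronglyConnected.dist_ne_top (h : StronglyConnected G) (s t : V) :
    dist G none s t ≠ ⊤ := by
  have := h s t
  induction this with
  | refl =>
    have : IsWalk G none s s [s] := ⟨rfl, rfl, by simp, by simp⟩
    exact ne_top_of_le_ne_top (ENat.natCast_ne_top _) (dist_le_of_isWalk this)
  | @tail b c _ hbc ih =>
    have : IsWalk G none b c [b, c] := ⟨rfl, rfl, by simp, by simpa using hbc⟩
    refine ne_top_of_le_ne_top ?_ (dist_triangle s b c)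
    exact WithTop.add_ne_top.2
      ⟨ih, ne_top_of_le_ne_top (ENat.natCast_ne_top _) (dist_le_of_isWalk this)⟩

theorem inRange_iff_of_eq {k : ℕ} {d : ℕ∞} {a b : ℝ} (h : d = k) :
    InRange d a b ↔ a < k ∧ (k : ℝ) ≤ b := by
  subst h
  constructor
  · rintro ⟨m, hm, h⟩
    rwa [Nat.cast_inj.1 hm]
  · exact fun h => ⟨k, rfl, h⟩

end Walks

/-! ### Greedy hitting sets -/

section Greedy

variable {V ι : Type*} {path : ι → List V} {S : Finset ι} {B : Finset V}

theorem GreedyRun.hits (h : GreedyRun path S B) : ∀ q ∈ S, ∃ v ∈ B, v ∈ path q := by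
  induction h with
  | done => simp
  | pick S v B hne hmax hrun ih =>
    intro q hq
    by_cases hv : v ∈ path q
    · exact ⟨v, by simp, hv⟩
    · obtain ⟨w, hw, hwq⟩ := ih q (by simp [hq, hv])
      exact ⟨w, by simp [hw], hwq⟩

open Classical in
/-- The members of `S` whose path contains `v`. -/
noncomputable def through (path : ι → List V) (S : Finset ι) (v : V) : Finset ι :=
  S.filter fun q => v ∈ path q

@[simp] theorem mem_through {v : V} {q : ι} : q ∈ through path S v ↔ q ∈ S ∧ v ∈ path q := by
  simp [through]

/-- Double counting of the incidences between vertices and paths. -/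
theorem sum_card_through [Fintype V] (hnodup : ∀ q ∈ S, (path q).Nodup) :
    ∑ v : V, (through path S v).card = ∑ q ∈ S, (path q).length := by
  classical
  have : ∀ q ∈ S, (path q).length = ∑ v : V, if v ∈ path q then 1 else 0 := by
    intro q hq
    rw [Finset.sum_boole, ← List.toFinset_card_of_nodup (hnodup q hq), Nat.cast_id]
    congr 1
    ext u; simp
  rw [Finset.sum_congr rfl this, Finset.sum_comm]
  refine Finset.sum_congr rfl fun v _ => ?_
  rw [Finset.sum_boole, Nat.cast_id]
  congr 1

/-- If all paths have at least `ℓ` vertices, then a vertex on the largest number of paths lies on a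
fraction of at least `ℓ / n` of them. -/
theorem card_mul_le_card_mul_of_max [Fintype V] {ℓ : ℝ}
    (hnodup : ∀ q ∈ S, (path q).Nodup) (hlen : ∀ q ∈ S, ℓ ≤ (path q).length) {v : V}
    (hmax : ∀ u : V, (through path S u).card ≤ (through path S v).card) :
    S.card * ℓ ≤ Fintype.card V * ((through path S v).card : ℝ) := by
  calc S.card * ℓ = ∑ q ∈ S, ℓ := by simp
    _ ≤ ∑ q ∈ S, ((path q).length : ℝ) := Finset.sum_le_sum hlen
    _ = ∑ u : V, ((through path S u).card : ℝ) := by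
        exact_mod_cast (sum_card_through hnodup).symm
    _ ≤ ∑ u : V, ((through path S v).card : ℝ) :=
        Finset.sum_le_sum fun u _ => by exact_mod_cast hmax u
    _ = _ := by simp

theorem GreedyRun.eq_empty (h : GreedyRun path ∅ B) : B = ∅ := by
  generalize hS : (∅ : Finset ι) = S at h
  cases h with
  | done => rfl
  | pick S v B hne => exact absurd hS.symm hne.ne_empty

open Classical in
/-- The logarithmic bound for the greedy algorithm: each selection reduces the number of unhit
paths by a factor of `1 - ℓ / n`. -/
theorem GreedyRun.card_le [Fintype V] {ℓ : ℝ} (hℓ : 0 < ℓ) (h : GreedyRun path S B)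
    (hnodup : ∀ q ∈ S, (path q).Nodup) (hlen : ∀ q ∈ S, ℓ ≤ (path q).length) :
    (B.card : ℝ) ≤ 1 + Fintype.card V / ℓ * Real.log S.card := by
  induction h with
  | done => simp
  | pick S v B hne hmax hrun ih =>
    have hcard : ((insert v B).card : ℝ) ≤ B.card + 1 := by
      exact_mod_cast Finset.card_insert_le v B
    have hS0 : (0 : ℝ) < S.card := by exact_mod_cast hne.card_pos
    have hS1 : (1 : ℝ) ≤ S.card := by exact_mod_cast hne.card_pos
    have hn : (0 : ℝ) < Fintype.card V := by
      have : Nonempty V := ⟨v⟩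
      exact_mod_cast Fintype.card_pos
    rcases (S.filter fun q => v ∉ path q).eq_empty_or_nonempty with he | hne'
    · rw [he] at hrun
      have := hrun.eq_empty
      subst this
      have : 0 ≤ Fintype.card V / ℓ * Real.log S.card :=
        mul_nonneg (by positivity) (Real.log_nonneg hS1)
      simp only [Finset.card_empty, Nat.cast_zero, zero_add] at hcard
      linarith
    · have ih := ih (fun q hq => hnodup q (Finset.mem_filter.1 hq).1)
        (fun q hq => hlen q (Finset.mem_filter.1 hq).1)
      have hdc := card_mul_le_card_mul_of_max hnodup hlen hmax
      have hsplit : ((through path S v).card : ℝ)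
          + (S.filter fun q => v ∉ path q).card = S.card := by
        exact_mod_cast Finset.card_filter_add_card_filter_not (fun q => v ∈ path q)
      have hS'0 : (0 : ℝ) < (S.filter fun q => v ∉ path q).card := by
        exact_mod_cast hne'.card_pos
      have hlog : Real.log (S.filter fun q => v ∉ path q).card
          ≤ Real.log S.card - ℓ / Fintype.card V := by
        have h1 := Real.log_le_sub_one_of_pos (div_pos hS'0 hS0)
        rw [Real.log_div hS'0.ne' hS0.ne'] at h1
        have h2 : ((S.filter fun q => v ∉ path q).card : ℝ) / S.card - 1
            ≤ - (ℓ / Fintype.card V) := by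
          rw [div_sub_one hS0.ne', ← neg_div, div_le_div_iff₀ hS0 hn]
          nlinarith
        linarith
      have := mul_le_mul_of_nonneg_left hlog (show 0 ≤ Fintype.card V / ℓ by positivity)
      rw [mul_sub, show Fintype.card V / ℓ * (ℓ / Fintype.card V) = 1 by field_simp] at this
      linarith

end Greedy

/-! ### Size and hitting property of the pivot sets -/

section Pivots

variable {V : Type*} {G : Digraph V} {C : ℝ} {A : APSPData G} {D : DSO G}
  {B : ℕ → Finset V}

open Classical in
/-- The pivots `X` of the three stages before stage `i`. -/
noncomputable def recent (B : ℕ → Finset V) (i : ℕ) : Finset V :=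
  B (i - 3) ∪ B (i - 2) ∪ B (i - 1)

theorem IsCritical.isShortestPath {X : Finset V} {i : ℕ} {x y : V} {F : Option (Failure V)}
    (h : IsCritical C A X i x y F) : IsShortestPath G F x y (reported A D x y F) ∧
      InRange (dist G F x y) (C ^ ((i : ℤ) - 6)) (C ^ (i + 1)) := by
  cases F with
  | none =>
    obtain ⟨-, -, h⟩ := h
    obtain ⟨k, hk, -⟩ := id h
    exact ⟨A.isShortestPath x y (by simp [hk]), h⟩
  | some f =>
    obtain ⟨-, -, ⟨k, hk, -⟩, hf, h⟩ := h
    obtain ⟨k', hk', -⟩ := id h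
    have hA := A.isShortestPath x y (by simp [hk])
    exact ⟨D.isShortestPath x y f (hA.1.isIn_of_onPath hf) (by simp [hk']), h⟩

theorem mem_critical [Fintype V] {X : Finset V} {i : ℕ} {q : V × V × Option (Failure V)} :
    q ∈ critical C A X i ↔ IsCritical C A X i q.1 q.2.1 q.2.2 := by
  simp [critical]

/-- If `x` and `y` are recent pivots whose distance in `G - F` is in the range of stage `i`, then
the collection holds a shortest path between them in `G - F`: `P(x,y)` if this path avoids the
failure, and the replacement path otherwise. -/
theorem exists_hit_of_recent [Fintype V] (hrun : IsHDPHRun C A D B) {i : ℕ} (hi3 : 3 ≤ i)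
    (hi : i ≤ ceilLog C (Fintype.card V)) {F : Option (Failure V)} {x y : V}
    (hx : x ∈ recent B i) (hy : y ∈ recent B i)
    (hd : InRange (dist G F x y) (C ^ ((i : ℤ) - 6)) (C ^ (i + 1))) :
    ∃ z ∈ B i, dist G F x y = dist G F x z + dist G F z y := by
  have hstep := hrun.step i hi3 hi
  suffices ∃ F', IsCritical C A (recent B i) i x y F' ∧
      IsShortestPath G F x y (reported A D x y F') by
    obtain ⟨F', hc, hsp⟩ := this
    obtain ⟨z, hz, hzp⟩ := hstep.hits (x, y, F') (mem_critical.2 hc)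
    exact ⟨z, hz, hsp.dist_eq_add hzp⟩
  obtain ⟨k, hk, hk1, hk2⟩ := id hd
  cases F with
  | none =>
    have hc : IsCritical C A (recent B i) i x y none := ⟨hx, hy, hd⟩
    exact ⟨none, hc, hc.isShortestPath.1⟩
  | some f =>
    have hle : dist G none x y ≤ k := by
      rw [← hk]; exact dist_none_le
    obtain ⟨m, hm⟩ := ENat.ne_top_iff_exists.1 (ne_top_of_le_ne_top (ENat.natCast_ne_top _) hle)
    have hmk : m ≤ k := by
      rw [← hm] at hle; exact_mod_cast hle
    have hsp := A.isShortestPath x y (by simp [← hm])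
    by_cases hf : f.OnPath (A.path x y)
    · have hc : IsCritical C A (recent B i) i x y (some f) :=
        ⟨hx, hy, ⟨m, hm.symm, le_trans (by exact_mod_cast hmk) hk2⟩, hf, hd⟩
      exact ⟨some f, hc, hc.isShortestPath.1⟩
    · have hsp' := hsp.of_not_onPath hf
      have he : dist G none x y = dist G (some f) x y := by rw [← hsp.2, hsp'.2]
      exact ⟨none, ⟨hx, hy, he ▸ hd⟩, hsp'⟩

/-- The first stages see all vertices, since `B 2` is everything. -/
theorem recent_eq_univ [Fintype V] (hrun : IsHDPHRun C A D B) {i : ℕ} (hi : i ≤ 5) (z : V) :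
    z ∈ recent B i := by
  have := hrun.init (i - 3) (by omega)
  simp [recent, this]

theorem mem_recent {i j : ℕ} {z : V} (hz : z ∈ B j) (h1 : j < i) (h2 : i ≤ j + 3) :
    z ∈ recent B i := by
  obtain h | h | h : j = i - 3 ∨ j = i - 2 ∨ j = i - 1 := by omega
  all_goals subst h; simp [recent, hz]

/-- For `i ≥ 6` there is a length `a` that is dealt with by one of the three stages before `i`, and
that is so small that cutting it off both ends leaves a path of the range of stage `i`. -/
theorem exists_short_length (hC : 3 / 2 ≤ C) {i : ℕ} (hi : 6 ≤ i) :
    ∃ a j : ℕ, j < i ∧ i ≤ j + 3 ∧ C ^ j < a ∧ (a : ℝ) ≤ C ^ (j + 1) ∧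
      2 * (a : ℝ) + C ^ ((i : ℤ) - 6) ≤ C ^ i := by
  obtain ⟨m, rfl⟩ := Nat.exists_eq_add_of_le' hi
  have hC0 : 0 < C := by linarith
  have hC3 : 27 / 8 ≤ C ^ 3 := by
    calc (27 / 8 : ℝ) = (3 / 2) ^ 3 := by norm_num
      _ ≤ C ^ 3 := by gcongr
  have hm1 : 1 ≤ C ^ m := one_le_pow₀ (by linarith)
  have hm3 : 27 / 8 ≤ C ^ (m + 3) := by rw [pow_add]; nlinarith
  set a := ⌊C ^ (m + 3)⌋₊ + 1 with ha
  have h1 : C ^ (m + 3) < a := by rw [ha]; push_cast; exact Nat.lt_floor_add_one _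
  have h2 : (a : ℝ) ≤ C ^ (m + 3) + 1 := by
    rw [ha]; push_cast
    linarith [Nat.floor_le (show 0 ≤ C ^ (m + 3) by positivity)]
  have h6 : C ^ (m + 6) = C ^ (m + 3) * C ^ 3 := by ring
  have h3 : (a : ℝ) ≤ C ^ (m + 6) := by rw [h6]; nlinarith
  have hz : C ^ (((m + 6 : ℕ) : ℤ) - 6) = C ^ m := by
    rw [show ((m + 6 : ℕ) : ℤ) - 6 = (m : ℕ) by push_cast; ring, zpow_natCast]
  have h4 : 2 * (a : ℝ) + C ^ (((m + 6 : ℕ) : ℤ) - 6) ≤ C ^ (m + 6) := by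
    rw [hz]
    have : C ^ (m + 3) = C ^ m * C ^ 3 := by ring
    have hu : 3 + 2 * C ^ 3 ≤ C ^ 3 * C ^ 3 := by nlinarith
    have h7 : C ^ (m + 6) = C ^ m * (C ^ 3 * C ^ 3) := by ring
    rw [h7]
    nlinarith
  by_cases hA : (a : ℝ) ≤ C ^ (m + 4)
  · exact ⟨a, m + 3, by omega, by omega, h1, hA, h4⟩
  by_cases hB : (a : ℝ) ≤ C ^ (m + 5)
  · exact ⟨a, m + 4, by omega, by omega, not_le.1 hA, hB, h4⟩
  · exact ⟨a, m + 5, by omega, by omega, not_le.1 hB, h3, h4⟩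

/-- The hitting property, by strong induction on the stage: the pivots of the three previous stages
hit a short prefix and a short suffix of the path, and what is between the two hits is in the range
of the stage. -/
theorem IsHDPHRun.exists_pivot [Fintype V] (hC : 3 / 2 ≤ C) (hrun : IsHDPHRun C A D B)
    (F : Option (Failure V)) (i : ℕ) : i ≤ ceilLog C (Fintype.card V) → ∀ s t : V,
    InRange (dist G F s t) (C ^ i) (C ^ (i + 1)) →
    ∃ z ∈ B i, dist G F s t = dist G F s z + dist G F z t := by
  induction i using Nat.strong_induction_on with
  | _ i ih =>
  intro hi s t hd
  have hC0 : 0 < C := by linarith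
  obtain ⟨k, hk, hk1, hk2⟩ := id hd
  rcases Nat.lt_or_ge i 3 with hi3 | hi3
  · have := (dist_self_of_ne_top (G := G) (F := F) (s := s) (u := t) (by simp [hk])).1
    exact ⟨s, by simp [hrun.init i (by omega)], by simp [this]⟩
  rcases Nat.lt_or_ge i 6 with hi6 | hi6
  · refine exists_hit_of_recent hrun hi3 hi (recent_eq_univ hrun (by omega) s)
      (recent_eq_univ hrun (by omega) t) ⟨k, hk, lt_of_le_of_lt ?_ hk1, hk2⟩
    rw [← zpow_natCast]
    exact zpow_le_zpow_right₀ (by linarith) (by omega)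
  obtain ⟨a, j, hji, hij, ha1, ha2, ha3⟩ := exists_short_length hC hi6
  have hak : 2 * a < k := by
    have : 0 < C ^ ((i : ℤ) - 6) := by positivity
    have : (2 * (a : ℝ)) < k := by linarith
    exact_mod_cast this
  obtain ⟨p, hp1, hp2⟩ := exists_dist_eq hk (show a ≤ k by omega)
  obtain ⟨r, hr1, hr2⟩ := exists_dist_eq hp2 (show k - 2 * a ≤ k - a by omega)
  rw [show k - a - (k - 2 * a) = a by omega] at hr2
  obtain ⟨x, hx, hxd⟩ := ih j hji (by omega) s p ⟨a, hp1, ha1, ha2⟩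
  obtain ⟨y, hy, hyd⟩ := ih j hji (by omega) r t ⟨a, hr2, ha1, ha2⟩
  have hxy : dist G F x y ≤ dist G F x p + (dist G F p r + dist G F r y) :=
    (dist_triangle x p y).trans (add_le_add_right (dist_triangle p r y) _)
  have hst : dist G F s t ≤ dist G F s x + (dist G F x y + dist G F y t) :=
    (dist_triangle s x t).trans (add_le_add_right (dist_triangle x y t) _)
  rw [hp1] at hxd
  rw [hr2] at hyd
  rw [hr1] at hxy
  obtain ⟨sx, hsx⟩ := ENat.ne_top_iff_exists.1 (show dist G F s x ≠ ⊤ by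
    intro h; simp [h] at hxd)
  obtain ⟨xp, hxp⟩ := ENat.ne_top_iff_exists.1 (show dist G F x p ≠ ⊤ by
    intro h; simp [h] at hxd)
  obtain ⟨ry, hry⟩ := ENat.ne_top_iff_exists.1 (show dist G F r y ≠ ⊤ by
    intro h; simp [h] at hyd)
  obtain ⟨yt, hyt⟩ := ENat.ne_top_iff_exists.1 (show dist G F y t ≠ ⊤ by
    intro h; simp [h] at hyd)
  rw [← hxp, ← hry] at hxy
  obtain ⟨xy, hxy'⟩ := ENat.ne_top_iff_exists.1 (show dist G F x y ≠ ⊤ from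
    ne_top_of_le_ne_top (by
      rw [← Nat.cast_add, ← Nat.cast_add]
      exact ENat.natCast_ne_top _) hxy)
  rw [← hxy', ← hsx, ← hyt, hk] at hst
  rw [← hsx, ← hxp] at hxd
  rw [← hry, ← hyt] at hyd
  rw [← hxy'] at hxy
  norm_cast at hxd hyd hxy hst
  have hxy_low : C ^ ((i : ℤ) - 6) < xy := by
    have : ((k : ℕ) : ℝ) ≤ 2 * a + xy := by exact_mod_cast (by omega : k ≤ 2 * a + xy)
    linarith
  have hxy_up : (xy : ℝ) ≤ C ^ (i + 1) := le_trans (by exact_mod_cast (by omega : xy ≤ k)) hk2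
  obtain ⟨z, hz, hzd⟩ := exists_hit_of_recent hrun hi3 hi (mem_recent hx hji hij)
    (mem_recent hy hji hij) ⟨xy, hxy'.symm, hxy_low, hxy_up⟩
  refine ⟨z, hz, le_antisymm (dist_triangle s z t) ?_⟩
  calc dist G F s z + dist G F z t
      ≤ (dist G F s x + dist G F x z) + (dist G F z y + dist G F y t) :=
        add_le_add (dist_triangle s x z) (dist_triangle z y t)
    _ = dist G F s x + (dist G F x z + dist G F z y) + dist G F y t := by
        simp only [add_assoc]
    _ = ((sx + xy + yt : ℕ) : ℕ∞) := by
        rw [← hzd, ← hsx, ← hxy', ← hyt]; push_cast; rfl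
    _ ≤ dist G F s t := by
        rw [hk]
        exact_mod_cast (by omega : sx + xy + yt ≤ k)

theorem card_labels_le (n : ℕ) :
    Fintype.card (Fin n × Fin n × Option (Failure (Fin n))) ≤ (n + 2) ^ 4 := by
  simp only [Fintype.card_prod, Fintype.card_fin, Fintype.card_option, Fintype.card_sum]
  nlinarith [Nat.zero_le n, Nat.zero_le (n ^ 2), Nat.zero_le (n ^ 3), Nat.zero_le (n ^ 4)]

theorem one_le_log_add_two {n : ℕ} (hn : 0 < n) : 1 ≤ Real.log (n + 2) := by
  rw [Real.le_log_iff_exp_le (by positivity)]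
  have : (1 : ℝ) ≤ n := by exact_mod_cast hn
  linarith [Real.exp_one_lt_d9]

theorem lt_of_lt_ceilLog (hC : 1 < C) {n i : ℕ} (hn : 0 < n) : i < ceilLog C n ↔ C ^ i < n := by
  rw [ceilLog, Nat.lt_ceil, Real.lt_logb_iff_rpow_lt hC (by exact_mod_cast hn), Real.rpow_natCast]

theorem pow_le_of_le_ceilLog (hC : 1 < C) {n i : ℕ} (hn : 0 < n) (hi : i ≤ ceilLog C n) :
    C ^ i ≤ C * n := by
  have hn' : (1 : ℝ) ≤ n := by exact_mod_cast hn
  cases i with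
  | zero => simp; nlinarith
  | succ i =>
    have := (lt_of_lt_ceilLog hC hn).1 hi
    rw [pow_succ']
    exact mul_le_mul_of_nonneg_left this.le (by linarith)

/-- Each path of stage `i` has more than `C ^ (i - 6)` vertices, so the greedy algorithm selects
`O(n log n / C ^ i)` of them. -/
theorem IsHDPHRun.card_le {n : ℕ} (hn : 0 < n) {G : Digraph (Fin n)} {A : APSPData G} {D : DSO G}
    {B : ℕ → Finset (Fin n)} (hC : 3 / 2 ≤ C) {i : ℕ} (hi : i ≤ ceilLog C n)
    (hinit : i ≤ 2 → B i = Finset.univ)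
    (hstep : 3 ≤ i → GreedyRun
      (fun q : Fin n × Fin n × Option (Failure (Fin n)) => reported A D q.1 q.2.1 q.2.2)
      (critical C A (recent B i) i) (B i)) :
    ((B i).card : ℝ) ≤ (C ^ 2 + 4 * C ^ 6) * (n / C ^ i) * Real.log (n + 2) := by
  have hC0 : 0 < C := by linarith
  have hL := one_le_log_add_two hn
  have hn' : (0 : ℝ) < n := by exact_mod_cast hn
  have hL0 : 0 < Real.log (n + 2) := by linarith
  rcases Nat.lt_or_ge i 3 with hi3 | hi3
  · rw [hinit (by omega)]
    simp only [Finset.card_univ, Fintype.card_fin]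
    have h1 : (n : ℝ) ≤ C ^ 2 * (n / C ^ i) := by
      rw [mul_div_assoc', le_div_iff₀ (by positivity), mul_comm]
      exact mul_le_mul_of_nonneg_right (pow_le_pow_right₀ (by linarith) (by omega)) hn'.le
    have h2 : C ^ 2 * (n / C ^ i) ≤ (C ^ 2 + 4 * C ^ 6) * (n / C ^ i) := by
      gcongr
      nlinarith [pow_pos hC0 6]
    nlinarith
  · have hcrit : ∀ q ∈ critical C A (recent B i) i, IsShortestPath G q.2.2 q.1 q.2.1
        (reported A D q.1 q.2.1 q.2.2) ∧ C ^ ((i : ℤ) - 6) ≤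
          (reported A D q.1 q.2.1 q.2.2).length := by
      intro q hq
      obtain ⟨h1, k, hk, hk1, -⟩ := (mem_critical.1 hq).isShortestPath (D := D)
      refine ⟨h1, hk1.le.trans ?_⟩
      rw [h1.length_eq hk]
      push_cast; linarith
    have h := (hstep hi3).card_le (zpow_pos hC0 ((i : ℤ) - 6))
      (fun q hq => (hcrit q hq).1.nodup) (fun q hq => (hcrit q hq).2)
    rw [Fintype.card_fin] at h
    have hlog : Real.log (critical C A (recent B i) i).card ≤ 4 * Real.log (n + 2) := by
      rcases (critical C A (recent B i) i).card.eq_zero_or_pos with h0 | h0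
      · rw [h0]; simp; linarith
      · have : Real.log ((n + 2 : ℝ) ^ 4) = 4 * Real.log (n + 2) := by
          rw [Real.log_pow]; norm_num
        rw [← this]
        refine Real.log_le_log (by exact_mod_cast h0) ?_
        exact_mod_cast (Finset.card_le_univ _).trans (card_labels_le n)
    have h1 : (1 : ℝ) ≤ C ^ 2 * (n / C ^ i) := by
      have := pow_le_of_le_ceilLog (show 1 < C by linarith) hn hi
      rw [mul_div_assoc', le_div_iff₀ (by positivity)]
      nlinarith [mul_pos hC0 hn']
    have hz : (n : ℝ) / C ^ ((i : ℤ) - 6) = C ^ 6 * (n / C ^ i) := by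
      rw [zpow_sub₀ hC0.ne', zpow_natCast]
      norm_cast
      field_simp
    rw [hz] at h
    have h2 : C ^ 6 * (n / C ^ i) * Real.log (critical C A (recent B i) i).card ≤
        C ^ 6 * (n / C ^ i) * (4 * Real.log (n + 2)) :=
      mul_le_mul_of_nonneg_left hlog (by positivity)
    have h3 : C ^ 2 * (n / C ^ i) * 1 ≤ C ^ 2 * (n / C ^ i) * Real.log (n + 2) :=
      mul_le_mul_of_nonneg_left hL (by positivity)
    linarith

end Pivots

/-! ### A program logic for the machine -/

section State

variable (σ : State) (r r' v a a' i j i' j' : ℕ) (x : ℝ) (p : List ℕ)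

@[simp] theorem State.setReg_reg : (σ.setReg r v).reg r' = if r' = r then v else σ.reg r' := by
  simp [State.setReg, Function.update_apply]

@[simp] theorem State.setReg_mem : (σ.setReg r v).mem = σ.mem := rfl

@[simp] theorem State.setReg_real : (σ.setReg r v).real = σ.real := rfl

@[simp] theorem State.setMem_reg : (σ.setMem a i j v).reg = σ.reg := rfl

@[simp] theorem State.setMem_mem : (σ.setMem a i j v).mem a' i' j' =
    if a' = a ∧ i' = i ∧ j' = j then v else σ.mem a' i' j' := rfl

@[simp] theorem State.setReal_reg : (σ.setReal r x).reg = σ.reg := rfl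

@[simp] theorem State.setReal_mem : (σ.setReal r x).mem = σ.mem := rfl

@[simp] theorem State.setReal_real :
    (σ.setReal r x).real r' = if r' = r then x else σ.real r' := by
  simp [State.setReal, Function.update_apply]

@[simp] theorem State.setRow_reg : (σ.setRow a i p).reg = σ.reg := rfl

@[simp] theorem State.setRow_real : (σ.setRow a i p).real = σ.real := rfl

@[simp] theorem State.setRow_mem : (σ.setRow a i p).mem a' i' j' =
    if a' = a ∧ i' = i then p.getD j' (σ.mem a' i' j') else σ.mem a' i' j' := rfl

end State

/-- Whether the program contains an instruction that writes the word register `r`. -/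
def Cmd.writesReg (r : ℕ) : Cmd → Bool
  | assign r' _ => decide (r = r')
  | queryDist r' _ _ _ => decide (r = r')
  | seq c₁ c₂ => c₁.writesReg r || c₂.writesReg r
  | ite _ c₁ c₂ => c₁.writesReg r || c₂.writesReg r
  | loop _ c => c.writesReg r
  | _ => false

/-- Whether the program contains an instruction that writes the array `a`. -/
def Cmd.writesArr (a : ℕ) : Cmd → Bool
  | store a' _ _ _ => decide (a = a')
  | queryPath a' _ _ _ _ => decide (a = a')
  | seq c₁ c₂ => c₁.writesArr a || c₂.writesArr a
  | ite _ c₁ c₂ => c₁.writesArr a || c₂.writesArr a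
  | loop _ c => c.writesArr a
  | _ => false

/-- Whether the program contains an instruction that writes the real register `r`. -/
def Cmd.writesReal (r : ℕ) : Cmd → Bool
  | realCast r' _ => decide (r = r')
  | realMul r' _ _ => decide (r = r')
  | realDiv r' _ _ => decide (r = r')
  | seq c₁ c₂ => c₁.writesReal r || c₂.writesReal r
  | ite _ c₁ c₂ => c₁.writesReal r || c₂.writesReal r
  | loop _ c => c.writesReal r
  | _ => false

/-- The states agree on everything that the program has no instruction to write to. -/
structure Cmd.Frame (c : Cmd) (σ σ' : State) : Prop where
  reg : ∀ r, c.writesReg r = false → σ'.reg r = σ.reg r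
  mem : ∀ a, c.writesArr a = false → σ'.mem a = σ.mem a
  real : ∀ r, c.writesReal r = false → σ'.real r = σ.real r

theorem Cmd.Frame.refl (c : Cmd) (σ : State) : c.Frame σ σ :=
  ⟨fun _ _ => rfl, fun _ _ => rfl, fun _ _ => rfl⟩

theorem Cmd.Frame.trans {c : Cmd} {σ₁ σ₂ σ₃ : State} (h : c.Frame σ₁ σ₂) (h' : c.Frame σ₂ σ₃) :
    c.Frame σ₁ σ₃ :=
  ⟨fun r hr => (h'.reg r hr).trans (h.reg r hr), fun r hr => (h'.mem r hr).trans (h.mem r hr),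
    fun r hr => (h'.real r hr).trans (h.real r hr)⟩

/-- Frames are monotone in the set of written locations. -/
theorem Cmd.Frame.mono {c c' : Cmd} {σ σ' : State} (h : c.Frame σ σ')
    (h1 : ∀ r, c'.writesReg r = false → c.writesReg r = false)
    (h2 : ∀ r, c'.writesArr r = false → c.writesArr r = false)
    (h3 : ∀ r, c'.writesReal r = false → c.writesReal r = false) : c'.Frame σ σ' :=
  ⟨fun r hr => h.reg r (h1 r hr), fun r hr => h.mem r (h2 r hr), fun r hr => h.real r (h3 r hr)⟩

section Logic

variable {n : ℕ} {G : Digraph (Fin n)} {A : APSPData G} {D : DSO G} {W : ℕ}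

theorem Exec.frame {c : Cmd} {σ σ' : State} {t : ℕ} (h : Exec A D W c σ σ' t) :
    c.Frame σ σ' := by
  induction h with
  | skip | loopFalse => exact .refl _ _
  | assign | realCast | realMul | realDiv | queryDist =>
    constructor <;> intro r hr <;> simp_all [Cmd.writesReg, Cmd.writesReal]
  | store σ a i j e =>
    refine ⟨fun _ _ => rfl, fun a' ha => ?_, fun _ _ => rfl⟩
    have : a' ≠ a := by simpa [Cmd.writesArr] using ha
    ext i j; simp [this]
  | queryPath σ a =>
    refine ⟨fun _ _ => rfl, fun a' ha => ?_, fun _ _ => rfl⟩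
    have : a' ≠ a := by simpa [Cmd.writesArr] using ha
    ext i j; simp [this]
  | seq c₁ c₂ _ _ _ _ _ _ _ ih₁ ih₂ =>
    refine (ih₁.mono ?_ ?_ ?_).trans (ih₂.mono ?_ ?_ ?_) <;>
      simp +contextual [Cmd.writesReg, Cmd.writesReal, Cmd.writesArr]
  | iteTrue _ c₁ c₂ _ _ _ _ _ ih =>
    refine ih.mono ?_ ?_ ?_ <;> simp +contextual [Cmd.writesReg, Cmd.writesReal, Cmd.writesArr]
  | iteFalse _ c₁ c₂ _ _ _ _ _ ih =>
    refine ih.mono ?_ ?_ ?_ <;> simp +contextual [Cmd.writesReg, Cmd.writesReal, Cmd.writesArr]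
  | loopTrue _ c _ _ _ _ _ _ _ _ ih₁ ih₂ =>
    refine (ih₁.mono ?_ ?_ ?_).trans ih₂ <;>
      simp +contextual [Cmd.writesReg, Cmd.writesReal, Cmd.writesArr]

variable (A D W) in
/-- Total correctness: started in `σ`, the program halts, and its final state and its running time
satisfy `Q`. -/
def Runs (c : Cmd) (σ : State) (Q : State → ℕ → Prop) : Prop :=
  ∃ σ' t, Exec A D W c σ σ' t ∧ Q σ' t

variable {σ : State} {Q Q' : State → ℕ → Prop} {c c₁ c₂ : Cmd}

theorem Runs.mono (h : Runs A D W c σ Q) (hQ : ∀ σ' t, c.Frame σ σ' → Q σ' t → Q' σ' t) :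
    Runs A D W c σ Q' := by
  obtain ⟨σ', t, he, hq⟩ := h
  exact ⟨σ', t, he, hQ _ _ he.frame hq⟩

theorem Runs.skip (h : Q σ 1) : Runs A D W .skip σ Q := ⟨_, _, .skip σ, h⟩

theorem Runs.assign {r : ℕ} {e : Expr} (hW : e.eval σ < W) (h : Q (σ.setReg r (e.eval σ)) 1) :
    Runs A D W (.assign r e) σ Q := ⟨_, _, .assign σ r e hW, h⟩

theorem Runs.store {a : ℕ} {i j e : Expr} (h1 : i.eval σ < W) (h2 : j.eval σ < W)
    (h3 : e.eval σ < W) (h : Q (σ.setMem a (i.eval σ) (j.eval σ) (e.eval σ)) 1) :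
    Runs A D W (.store a i j e) σ Q := ⟨_, _, .store σ a i j e h1 h2 h3, h⟩

theorem Runs.realCast {r : ℕ} {e : Expr} (hW : e.eval σ < W)
    (h : Q (σ.setReal r (e.eval σ)) 1) : Runs A D W (.realCast r e) σ Q :=
  ⟨_, _, .realCast σ r e hW, h⟩

theorem Runs.realMul {r r₁ r₂ : ℕ} (h : Q (σ.setReal r (σ.real r₁ * σ.real r₂)) 1) :
    Runs A D W (.realMul r r₁ r₂) σ Q := ⟨_, _, .realMul σ r r₁ r₂, h⟩

theorem Runs.realDiv {r r₁ r₂ : ℕ} (h : Q (σ.setReal r (σ.real r₁ / σ.real r₂)) 1) :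
    Runs A D W (.realDiv r r₁ r₂) σ Q := ⟨_, _, .realDiv σ r r₁ r₂, h⟩

theorem Runs.seq (h : Runs A D W c₁ σ fun σ₁ t₁ => Runs A D W c₂ σ₁ fun σ₂ t₂ => Q σ₂ (t₁ + t₂)) :
    Runs A D W (.seq c₁ c₂) σ Q := by
  obtain ⟨σ₁, t₁, h₁, σ₂, t₂, h₂, h⟩ := h
  exact ⟨_, _, .seq _ _ _ _ _ _ _ h₁ h₂, h⟩

theorem Runs.ite {b : Cond} (h1 : b.Holds σ → Runs A D W c₁ σ fun σ' t => Q σ' (1 + t))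
    (h2 : ¬ b.Holds σ → Runs A D W c₂ σ fun σ' t => Q σ' (1 + t)) :
    Runs A D W (.ite b c₁ c₂) σ Q := by
  by_cases hb : b.Holds σ
  · obtain ⟨σ', t, he, h⟩ := h1 hb
    exact ⟨_, _, .iteTrue _ _ _ _ _ _ hb he, h⟩
  · obtain ⟨σ', t, he, h⟩ := h2 hb
    exact ⟨_, _, .iteFalse _ _ _ _ _ _ hb he, h⟩

/-- The rule for loops. The invariant `I μ σ τ` speaks of a termination measure `μ`, the state `σ`
and the time `τ` that has elapsed since the loop was entered. -/
theorem Runs.loop {b : Cond} {I : ℕ → State → ℕ → Prop} {μ₀ : ℕ} (h0 : I μ₀ σ 0)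
    (hstep : ∀ μ σ₁ τ, c.Frame σ σ₁ → I μ σ₁ τ → b.Holds σ₁ →
      Runs A D W c σ₁ fun σ₂ t => ∃ μ' < μ, I μ' σ₂ (τ + t + 1))
    (hend : ∀ μ σ' τ, c.Frame σ σ' → I μ σ' τ → ¬ b.Holds σ' → Q σ' (τ + 1)) :
    Runs A D W (.loop b c) σ Q := by
  suffices ∀ μ σ₁ τ, c.Frame σ σ₁ → I μ σ₁ τ →
      Runs A D W (.loop b c) σ₁ fun σ' t => Q σ' (τ + t) by
    simpa using this μ₀ σ 0 (.refl _ _) h0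
  intro μ
  induction μ using Nat.strong_induction_on with
  | _ μ ih =>
  intro σ₁ τ hF hI
  by_cases hb : b.Holds σ₁
  · obtain ⟨σ₂, t, he, μ', hμ, hI'⟩ := hstep μ σ₁ τ hF hI hb
    obtain ⟨σ₃, t', he', hQ⟩ := ih μ' hμ σ₂ _ (hF.trans he.frame) hI'
    refine ⟨σ₃, _, .loopTrue _ _ _ _ _ _ _ hb he he', ?_⟩
    show Q σ₃ (τ + (1 + t + t'))
    rwa [show τ + (1 + t + t') = τ + t + 1 + t' by ring]
  · exact ⟨σ₁, _, .loopFalse _ _ _ hb, hend μ σ₁ τ hF hI hb⟩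

/-- `for r := 0, …, (register rb) - 1 do c`. -/
def Cmd.for (r rb : ℕ) (c : Cmd) : Cmd :=
  .seq (.assign r (.const 0))
    (.loop (.not (.le (.reg rb) (.reg r))) (.seq c (.assign r (.add (.reg r) (.const 1)))))

/-- The rule for counting loops; `τ` is the time elapsed so far. -/
theorem Runs.for {r rb : ℕ} {I : ℕ → State → ℕ → Prop} (hne : rb ≠ r)
    (hr : c.writesReg r = false) (hrb : c.writesReg rb = false) (hW : σ.reg rb < W)
    (hI : ∀ k σ τ v, I k σ τ → I k (σ.setReg r v) τ) (h0 : I 0 σ 1)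
    (hstep : ∀ k σ₁ τ, k < σ.reg rb → (Cmd.for r rb c).Frame σ σ₁ → σ₁.reg r = k → I k σ₁ τ →
      Runs A D W c σ₁ fun σ₂ t => I (k + 1) σ₂ (τ + t + 2))
    (hend : ∀ σ' τ, (Cmd.for r rb c).Frame σ σ' → I (σ.reg rb) σ' τ → Q σ' (τ + 1)) :
    Runs A D W (Cmd.for r rb c) σ Q := by
  have hassign : (Cmd.for r rb c).Frame σ (σ.setReg r 0) := by
    refine (Exec.frame (A := A) (D := D) (W := W)
      (.assign σ r (.const 0) (by simp only [Expr.eval]; omega))).mono ?_ ?_ ?_ <;>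
      simp +contextual [Cmd.for, Cmd.writesReg, Cmd.writesReal, Cmd.writesArr]
  have hbody : ∀ {σ₁ σ₂ : State},
      (Cmd.seq c (.assign r (.add (.reg r) (.const 1)))).Frame σ₁ σ₂ →
      (Cmd.for r rb c).Frame σ₁ σ₂ := by
    intro σ₁ σ₂ h
    refine h.mono ?_ ?_ ?_ <;>
      simp +contextual [Cmd.for, Cmd.writesReg, Cmd.writesReal, Cmd.writesArr]
  have hrbF : (Cmd.for r rb c).writesReg rb = false := by
    simp [Cmd.for, Cmd.writesReg, hrb, hne]
  refine .seq (.assign (by simp only [Expr.eval]; omega) (.loop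
    (I := fun μ σ₁ τ => ∃ k, k + μ = σ.reg rb ∧ σ₁.reg r = k ∧ I k σ₁ (τ + 1))
    (μ₀ := σ.reg rb) ⟨0, by simp, by simp [Expr.eval], hI _ _ _ _ h0⟩ ?_ ?_))
  · rintro μ σ₁ τ hF ⟨k, hk, hk', hI1⟩ hb
    have hF' := hassign.trans (hbody hF)
    have hrb1 := hF'.reg rb hrbF
    simp only [Cond.Holds, Expr.eval, hrb1, hk'] at hb
    refine .seq ((hstep k σ₁ _ (by omega) hF' hk' hI1).mono fun σ₂ t hF2 hI2 => ?_)
    have hk2 : σ₂.reg r = k := (hF2.reg r hr).trans hk'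
    refine .assign (by simp only [Expr.eval, hk2]; omega)
      ⟨μ - 1, by omega, k + 1, by omega, by simp [Expr.eval, hk2], hI _ _ _ _ ?_⟩
    convert hI2 using 1
    ring
  · rintro μ σ' τ hF ⟨k, hk, hk', hI1⟩ hb
    have hF' := hassign.trans (hbody hF)
    simp only [Cond.Holds, Expr.eval, hF'.reg rb hrbF, hk'] at hb
    obtain rfl : k = σ.reg rb := by omega
    rw [show 1 + (τ + 1) = τ + 1 + 1 by ring]
    exact hend σ' _ hF' hI1

theorem Runs.queryDist {r : ℕ} {ex ey : Expr} {eF : Option (Failure Expr)} (x y : Fin n)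
    (F : Option (Failure (Fin n))) (hx : ex.eval σ = x) (hy : ey.eval σ = y)
    (hF : mapFailure (fun e => e.eval σ) eF = mapFailure Fin.val F) (hin : ∀ f ∈ F, f.IsIn G)
    (hW : distWord n (dist G F x y) < W) (h : Q (σ.setReg r (distWord n (dist G F x y))) 1) :
    Runs A D W (.queryDist r ex ey eF) σ Q :=
  ⟨_, _, .queryDist σ r ex ey eF x y F hx hy hF hin hW, h⟩

theorem Runs.queryPath {a : ℕ} {i ex ey : Expr} {eF : Option (Failure Expr)} (x y : Fin n)
    (F : Option (Failure (Fin n))) (hi : i.eval σ < W) (hn : n ≤ W)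
    (hx : ex.eval σ = x) (hy : ey.eval σ = y)
    (hF : mapFailure (fun e => e.eval σ) eF = mapFailure Fin.val F) (hin : ∀ f ∈ F, f.IsIn G)
    (htop : dist G F x y ≠ ⊤)
    (h : Q (σ.setRow a (i.eval σ) ((reported A D x y F).map Fin.val))
      (1 + (reported A D x y F).length)) :
    Runs A D W (.queryPath a i ex ey eF) σ Q :=
  ⟨_, _, .queryPath σ a i ex ey eF x y F hi hn hx hy hF hin htop, h⟩

end Logic

/-! ### The program -/

/-- The queries that address the APSP data and the DSO; a path of the collection is listed under
the query that reports it. -/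
abbrev Label (n : ℕ) := Fin n × Fin n × Option (Failure (Fin n))

/-- The number of an optional failure, less than `1 + n + n * n`. -/
def failureCode (n : ℕ) : Option (Failure ℕ) → ℕ
  | none => 0
  | some (Sum.inl v) => 1 + v
  | some (Sum.inr e) => 1 + n + (e.1 * n + e.2)

/-- The number of a label: the row of the arrays `2`, `3`, `4` where its path is kept. -/
def code {n : ℕ} (q : Label n) : ℕ :=
  (q.1 * n + q.2.1) * (1 + n + n * n) + failureCode n (mapFailure Fin.val q.2.2)

/-- The expression for `failureCode`. -/
def failureCodeExpr : Option (Failure Expr) → Expr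
  | none => .const 0
  | some (Sum.inl v) => .add (.const 1) v
  | some (Sum.inr e) =>
      .add (.add (.const 1) (.reg 0)) (.add (.mul e.1 (.reg 0)) e.2)

/-- Add the path whose number is in register `8` to the list of its vertex number (register `10`)
and to the count of this vertex. -/
def registerVertex : Cmd :=
  .seq (.assign 11 (.load 2 (.reg 8) (.reg 10))) <|
  .seq (.store 7 (.reg 11) (.load 6 (.reg 11) (.const 0)) (.reg 8)) <|
  .seq (.store 6 (.reg 11) (.const 0) (.add (.load 6 (.reg 11) (.const 0)) (.const 1)))
    (.store 5 (.reg 11) (.const 0) (.add (.load 5 (.reg 11) (.const 0)) (.const 1)))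

/-- Put the path for the pair in the registers `2`, `3` and the failure `F` into the collection if
its length is in the range given by the real registers `2` and `1`. -/
def tryPath (F : Option (Failure Expr)) : Cmd :=
  .seq (.assign 8 (.add (.mul (.add (.mul (.reg 2) (.reg 0)) (.reg 3))
    (.add (.add (.const 1) (.reg 0)) (.mul (.reg 0) (.reg 0)))) (failureCodeExpr F))) <|
  .seq (.queryDist 9 (.reg 2) (.reg 3) F) <|
  .ite (.and (.le (.add (.reg 9) (.const 1)) (.reg 0))
      (.and (.leReal (.reg 9) 1) (.not (.leReal (.reg 9) 2))))
    (.seq (.queryPath 2 (.reg 8) (.reg 2) (.reg 3) F) <|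
      .seq (.assign 16 (.add (.reg 9) (.const 1))) <|
      .seq (.store 3 (.reg 8) (.const 0) (.reg 16)) <|
      .seq (.store 4 (.reg 8) (.const 0) (.const 0)) <|
      .seq (.assign 12 (.add (.reg 12) (.const 1)))
        (.for 10 16 registerVertex))
    .skip

/-- The vertex in register `r` is a pivot of one of the last three stages. -/
def isRecent (r : ℕ) : Cond :=
  .le (.const 1) (.add (.load 0 (.sub (.reg 1) (.const 3)) (.reg r))
    (.add (.load 0 (.sub (.reg 1) (.const 2)) (.reg r))
      (.load 0 (.sub (.reg 1) (.const 1)) (.reg r))))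

/-- Put all paths for the pair in the registers `2`, `3` into the collection. -/
def collectPair : Cmd :=
  .ite (.and (isRecent 2) (isRecent 3))
    (.seq (.queryDist 4 (.reg 2) (.reg 3) none) <|
      .ite (.leReal (.reg 4) 1)
        (.seq (tryPath none) <|
          .seq (.queryPath 1 (.const 0) (.reg 2) (.reg 3) none) <|
          .seq (.assign 17 (.add (.reg 4) (.const 1))) <|
          .seq (.for 5 17
            (.seq (.assign 6 (.load 1 (.const 0) (.reg 5)))
              (tryPath (some (Sum.inl (.reg 6))))))
          (.for 5 4
            (.seq (.assign 6 (.load 1 (.const 0) (.reg 5))) <|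
              .seq (.assign 7 (.load 1 (.const 0) (.add (.reg 5) (.const 1))))
                (tryPath (some (Sum.inr (.reg 6, .reg 7)))))))
        .skip)
    .skip

/-- Find a vertex with the largest count. -/
def findBest : Cmd :=
  .seq (.assign 13 (.const 0)) <|
  .for 14 0
    (.ite (.le (.add (.load 5 (.reg 13) (.const 0)) (.const 1)) (.load 5 (.reg 14) (.const 0)))
      (.assign 13 (.reg 14)) .skip)

/-- If the path with number `k` (register `15`) in the list of the selected vertex is unhit, mark it
as hit and adjust the counts. -/
def hitPath : Cmd :=
  .seq (.assign 8 (.load 7 (.reg 13) (.reg 15))) <|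
  .ite (.le (.load 4 (.reg 8) (.const 0)) (.const 0))
    (.seq (.store 4 (.reg 8) (.const 0) (.const 1)) <|
      .seq (.assign 12 (.sub (.reg 12) (.const 1))) <|
      .seq (.assign 16 (.load 3 (.reg 8) (.const 0))) <|
      .for 10 16
        (.seq (.assign 11 (.load 2 (.reg 8) (.reg 10)))
          (.store 5 (.reg 11) (.const 0) (.sub (.load 5 (.reg 11) (.const 0)) (.const 1)))))
    .skip

/-- The greedy selection; register `12` holds the number of unhit paths. -/
def greedy : Cmd :=
  .loop (.le (.const 1) (.reg 12))
    (.seq findBest <|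
      .seq (.store 0 (.reg 1) (.reg 13) (.const 1)) <|
      .seq (.assign 18 (.load 6 (.reg 13) (.const 0))) <|
      .for 15 18 hitPath)

/-- One stage of the algorithm. -/
def stage : Cmd :=
  .seq (.for 14 0
    (.seq (.store 0 (.reg 1) (.reg 14) (.const 0)) <|
      .seq (.store 5 (.reg 14) (.const 0) (.const 0))
        (.store 6 (.reg 14) (.const 0) (.const 0)))) <|
  .seq (.assign 12 (.const 0)) <|
  .seq (.for 2 0 (.for 3 0 collectPair)) greedy

/-- The HDPH algorithm. Word registers: `0` holds `n`, `1` the stage `i`, `2` and `3` the current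
pair of vertices, `4` its distance, `6` and `7` the current failure, `8` the number of the current
path, `9` its length, `12` the number of unhit paths, `13` the selected vertex; the others are
auxiliary. Real registers: `0` holds `C`, `1` holds `C ^ (i + 1)`, `2` holds `C ^ (i - 6)`, `3`
holds `C ^ (i - 1)`.
Arrays: `0` holds the pivots, `1` the path of the current pair, `2` the paths by their numbers, `3`
their lengths, `4` whether they are hit, `5` the number of unhit paths through each vertex, `6` the
number of paths through each vertex, `7` the list of their numbers. -/
def hdph : Cmd :=
  .seq (.for 14 0
    (.seq (.store 0 (.const 0) (.reg 14) (.const 1)) <|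
      .seq (.store 0 (.const 1) (.reg 14) (.const 1))
        (.store 0 (.const 2) (.reg 14) (.const 1)))) <|
  .seq (.assign 1 (.const 3)) <|
  .seq (.realCast 4 (.const 1)) <|
  .seq (.realMul 3 0 0) <|
  .seq (.realMul 1 3 3) <|
  .seq (.realDiv 2 4 0) <|
  .seq (.realDiv 2 2 3) <|
  .loop (.not (.leReal (.reg 0) 3))
    (.seq stage <|
      .seq (.assign 1 (.add (.reg 1) (.const 1))) <|
      .seq (.realMul 1 1 0) <|
      .seq (.realMul 2 2 0) (.realMul 3 3 0))

/-! ### The numbering of the labels -/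

theorem failureCodeExpr_eval (σ : State) (F : Option (Failure Expr)) :
    (failureCodeExpr F).eval σ =
      failureCode (σ.reg 0) (mapFailure (fun e => e.eval σ) F) := by
  rcases F with _ | _ | _ <;> rfl

theorem failureCode_lt {n : ℕ} (F : Option (Failure (Fin n))) :
    failureCode n (mapFailure Fin.val F) < 1 + n + n * n := by
  rcases F with _ | v | ⟨u, v⟩
  · simp [mapFailure, failureCode]
  · simp [mapFailure, failureCode]
    have := v.2
    nlinarith
  · simp [mapFailure, failureCode]
    have := u.2
    have := v.2
    nlinarith

theorem pair_code_inj {n a b c d : ℕ} (hb : b < n) (hd : d < n) (h : a * n + b = c * n + d) :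
    a = c ∧ b = d := by
  have h1 : (a * n + b) / n = (c * n + d) / n := by rw [h]
  have h2 : (a * n + b) % n = (c * n + d) % n := by rw [h]
  rw [Nat.mul_comm a, Nat.mul_comm c, Nat.mul_add_div (by omega), Nat.mul_add_div (by omega),
    Nat.div_eq_of_lt hb, Nat.div_eq_of_lt hd] at h1
  rw [Nat.mul_comm a, Nat.mul_comm c, Nat.mul_add_mod, Nat.mul_add_mod,
    Nat.mod_eq_of_lt hb, Nat.mod_eq_of_lt hd] at h2
  exact ⟨by simpa using h1, h2⟩

theorem failureCode_injective {n : ℕ} {F F' : Option (Failure (Fin n))}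
    (h : failureCode n (mapFailure Fin.val F) = failureCode n (mapFailure Fin.val F')) :
    F = F' := by
  rcases F with _ | v | ⟨u, v⟩ <;> rcases F' with _ | v' | ⟨u', v'⟩ <;>
    simp only [mapFailure, failureCode, Option.map_some, Option.map_none, Sum.map_inl,
      Sum.map_inr, Prod.map] at h
  all_goals try omega
  · rfl
  · congr 2
    exact Fin.ext (by omega)
  · obtain ⟨h1, h2⟩ := pair_code_inj v.2 v'.2 (Nat.add_left_cancel h)
    rw [Fin.ext h1, Fin.ext h2]

theorem code_injective {n : ℕ} {q q' : Label n} (h : code q = code q') : q = q' := by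
  obtain ⟨x, y, F⟩ := q
  obtain ⟨x', y', F'⟩ := q'
  obtain ⟨h1, h2⟩ := pair_code_inj (failureCode_lt F) (failureCode_lt F') h
  obtain ⟨h3, h4⟩ : (x : ℕ) = x' ∧ (y : ℕ) = y' := pair_code_inj y.2 y'.2 h1
  rw [Fin.ext h3, Fin.ext h4, failureCode_injective h2]

theorem code_lt {n : ℕ} (q : Label n) : code q < (n + 2) ^ 4 := by
  obtain ⟨x, y, F⟩ := q
  have h1 := failureCode_lt F
  have h2 : (x : ℕ) * n + y < n * n := by
    have := x.2
    have := y.2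
    nlinarith
  have h3 : code (x, y, F) < n * n * (1 + n + n * n) := by
    calc code (x, y, F) < (x * n + y) * (1 + n + n * n) + (1 + n + n * n) :=
          Nat.add_lt_add_left h1 _
      _ = (x * n + y + 1) * (1 + n + n * n) := by ring
      _ ≤ _ := Nat.mul_le_mul_right _ h2
  nlinarith [Nat.zero_le n, Nat.zero_le (n ^ 2), Nat.zero_le (n ^ 3), Nat.zero_le (n ^ 4)]

/-! ### The stored collection -/

section Data

variable {n : ℕ} {G : Digraph (Fin n)} (A : APSPData G) (D : DSO G)

/-- The reported path with label `q`. -/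
def labelPath (q : Label n) : List (Fin n) := reported A D q.1 q.2.1 q.2.2

/-- The arrays `6` and `7` hold lists of the labels in `rel v`, for all `v`. -/
structure Index (σ : State) (rel : Fin n → Finset (Label n)) : Prop where
  card : ∀ v : Fin n, σ.mem 6 v 0 = (rel v).card
  complete : ∀ v, ∀ q ∈ rel v, ∃ k < (rel v).card, σ.mem 7 v k = code q
  sound : ∀ v, ∀ k < (rel v).card, ∃ q ∈ rel v, σ.mem 7 v k = code q

/-- Array `5` holds the numbers of labels in `rel v`, for all `v`. -/
def Counts (σ : State) (rel : Fin n → Finset (Label n)) : Prop :=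
  ∀ v : Fin n, σ.mem 5 v 0 = (rel v).card

/-- The arrays `2`, `3` and `4` hold the paths with labels in `S`, their lengths, and whether they
are outside the set `R` of unhit paths. -/
structure Stored (σ : State) (S R : Finset (Label n)) : Prop where
  subset : R ⊆ S
  nodup : ∀ q ∈ S, (labelPath A D q).Nodup
  path : ∀ q ∈ S, ∀ j (h : j < (labelPath A D q).length),
    σ.mem 2 (code q) j = ((labelPath A D q)[j] : ℕ)
  length : ∀ q ∈ S, σ.mem 3 (code q) 0 = (labelPath A D q).length
  unhit : ∀ q ∈ R, σ.mem 4 (code q) 0 = 0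
  hit : ∀ q ∈ S, q ∉ R → σ.mem 4 (code q) 0 = 1

/-- The machine holds the collection `S`, of which the paths in `R` are unhit. -/
structure Data (σ : State) (S R : Finset (Label n)) : Prop where
  stored : Stored A D σ S R
  index : Index σ (through (labelPath A D) S)
  counts : Counts σ (through (labelPath A D) R)
  unhit : σ.reg 12 = R.card

variable {A D}

theorem Index.insert {σ σ' : State} {rel : Fin n → Finset (Label n)} (h : Index σ rel)
    {u : Fin n} {q : Label n} (hq : q ∉ rel u)
    (h6 : ∀ v : Fin n, σ'.mem 6 v 0 = if v = u then σ.mem 6 u 0 + 1 else σ.mem 6 v 0)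
    (h7 : ∀ (v : Fin n) (k : ℕ),
      σ'.mem 7 v k = if v = u ∧ k = σ.mem 6 u 0 then code q else σ.mem 7 v k) :
    Index σ' (Function.update rel u (insert q (rel u))) := by
  refine ⟨fun v => ?_, fun v q' hq' => ?_, fun v k hk => ?_⟩ <;> by_cases hv : v = u
  · subst hv
    simp [h6, hq, h.card]
  · simp [h6, hv, h.card]
  · subst hv
    simp only [Function.update_self, Finset.mem_insert, Finset.card_insert_of_notMem hq] at hq' ⊢
    rcases hq' with rfl | hq'
    · exact ⟨(rel v).card, by omega, by simp [h7, h.card]⟩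
    · obtain ⟨k, hk, hk'⟩ := h.complete v q' hq'
      exact ⟨k, by omega, by simp [h7, h.card, hk.ne, hk']⟩
  · rw [Function.update_of_ne hv] at hq' ⊢
    obtain ⟨k, hk, hk'⟩ := h.complete v q' hq'
    exact ⟨k, hk, by simp [h7, hv, hk']⟩
  · subst hv
    simp only [Function.update_self, Finset.mem_insert, Finset.card_insert_of_notMem hq] at hk ⊢
    by_cases hk' : k = (rel v).card
    · exact ⟨q, by simp, by simp [h7, h.card, hk']⟩
    · obtain ⟨q', hq', hk''⟩ := h.sound v k (by omega)
      exact ⟨q', by simp [hq'], by simp [h7, h.card, hk', hk'']⟩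
  · rw [Function.update_of_ne hv] at hk ⊢
    obtain ⟨q', hq', hk''⟩ := h.sound v k hk
    exact ⟨q', hq', by simp [h7, hv, hk'']⟩

theorem Index.congr {σ σ' : State} {rel : Fin n → Finset (Label n)} (h : Index σ rel)
    (h6 : σ'.mem 6 = σ.mem 6) (h7 : σ'.mem 7 = σ.mem 7) : Index σ' rel :=
  ⟨by rw [h6]; exact h.card, by rw [h7]; exact h.complete, by rw [h7]; exact h.sound⟩

theorem Counts.congr {σ σ' : State} {rel : Fin n → Finset (Label n)} (h : Counts σ rel)
    (h5 : σ'.mem 5 = σ.mem 5) : Counts σ' rel := by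
  unfold Counts; rw [h5]; exact h

theorem Stored.congr {σ σ' : State} {S R : Finset (Label n)} (h : Stored A D σ S R)
    (h2 : σ'.mem 2 = σ.mem 2) (h3 : σ'.mem 3 = σ.mem 3) (h4 : σ'.mem 4 = σ.mem 4) :
    Stored A D σ' S R :=
  ⟨h.subset, h.nodup, by rw [h2]; exact h.path, by rw [h3]; exact h.length,
    by rw [h4]; exact h.unhit, by rw [h4]; exact h.hit⟩

open Classical in
/-- The labels in `S` through each vertex, together with `q` at the vertices in `l`. -/
noncomputable def throughAnd {V ι : Type*} (path : ι → List V) (S : Finset ι) (q : ι) (l : List V)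
    (v : V) : Finset ι :=
  through path S v ∪ if v ∈ l then {q} else ∅

theorem mem_throughAnd {V ι : Type*} {path : ι → List V} {S : Finset ι} {q : ι} {l : List V}
    {v : V} {q' : ι} :
    q' ∈ throughAnd path S q l v ↔ (q' ∈ S ∧ v ∈ path q') ∨ (v ∈ l ∧ q' = q) := by
  unfold throughAnd
  split_ifs with h <;> simp [h, or_comm]

end Data

/-! ### Collecting the paths -/

section Collect

variable {n : ℕ} {G : Digraph (Fin n)} {A : APSPData G} {D : DSO G} {W : ℕ}

theorem throughAnd_nil {V ι : Type*} {path : ι → List V} {S : Finset ι} {q : ι} :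
    throughAnd path S q [] = through path S := by
  ext v q'
  simp [mem_throughAnd]

theorem throughAnd_path {V ι : Type*} [DecidableEq ι] {path : ι → List V} {S : Finset ι} {q : ι} :
    throughAnd path S q (path q) = through path (insert q S) := by
  ext v q'
  simp only [mem_throughAnd, mem_through, Finset.mem_insert]
  constructor
  · rintro (⟨h1, h2⟩ | ⟨h1, rfl⟩)
    · exact ⟨.inr h1, h2⟩
    · exact ⟨.inl rfl, h1⟩
  · rintro ⟨rfl | h1, h2⟩
    · exact .inr ⟨h2, rfl⟩
    · exact .inl ⟨h1, h2⟩

theorem not_mem_throughAnd {V ι : Type*} {path : ι → List V} {S : Finset ι} {q : ι}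
    {l : List V} {u : V} (hq : q ∉ S) (hu : u ∉ l) : q ∉ throughAnd path S q l u := by
  simp [mem_throughAnd, hq, hu]

theorem throughAnd_eq_update {V ι : Type*} [DecidableEq V] [DecidableEq ι] {path : ι → List V}
    {S : Finset ι} {q : ι} {l l' : List V} {u : V} (h : ∀ v, v ∈ l' ↔ v ∈ l ∨ v = u) :
    throughAnd path S q l' =
      Function.update (throughAnd path S q l) u (insert q (throughAnd path S q l u)) := by
  ext v q'
  by_cases hv : v = u
  · subst hv
    rw [Function.update_self, Finset.mem_insert, mem_throughAnd, mem_throughAnd, h]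
    tauto
  · rw [Function.update_of_ne hv, mem_throughAnd, mem_throughAnd, h]
    tauto

theorem mem_take_succ_iff {V : Type*} {l : List V} {k : ℕ} (hk : k < l.length) (v : V) :
    v ∈ l.take (k + 1) ↔ v ∈ l.take k ∨ v = l[k] := by
  rw [List.take_add_one, List.getElem?_eq_getElem hk, List.mem_append, Option.toList_some,
    List.mem_singleton]

theorem mem_drop_iff {V : Type*} {l : List V} {k : ℕ} (hk : k < l.length) (v : V) :
    v ∈ l.drop k ↔ v ∈ l.drop (k + 1) ∨ v = l[k] := by
  rw [List.drop_eq_getElem_cons hk, List.mem_cons, or_comm]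

theorem getElem_notMem_take {V : Type*} {l : List V} (hl : l.Nodup) {k : ℕ} (hk : k < l.length) :
    l[k] ∉ l.take k := by
  intro h
  obtain ⟨i, hi, he⟩ := List.mem_take_iff_getElem.1 h
  have := (List.Nodup.getElem_inj_iff hl).1 he
  omega

theorem getElem_notMem_drop {V : Type*} {l : List V} (hl : l.Nodup) {k : ℕ} (hk : k < l.length) :
    l[k] ∉ l.drop (k + 1) := by
  have := hl.sublist (List.drop_sublist k l)
  rw [List.drop_eq_getElem_cons hk, List.nodup_cons] at this
  exact this.1

/-- Numbers of labels, and counters of them that are still to be incremented, fit in a word. -/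
theorem succ_pow_lt (n : ℕ) : (n + 2) ^ 4 + 1 < (n + 2) ^ 5 := by
  have : 1 ≤ (n + 2) ^ 4 := Nat.one_le_pow _ _ (by omega)
  have h2 : 2 < (n + 2) ^ 4 := by
    calc 2 < 2 ^ 4 := by norm_num
      _ ≤ (n + 2) ^ 4 := Nat.pow_le_pow_left (by omega) 4
  rw [pow_succ (n + 2) 4]
  nlinarith [Nat.zero_le n]

theorem lt_pow (n : ℕ) : n + 1 < (n + 2) ^ 4 := by
  calc n + 1 < (n + 2) ^ 1 := by simp
    _ ≤ (n + 2) ^ 4 := Nat.pow_le_pow_right (by omega) (by omega)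

theorem card_lt_pow (S : Finset (Label n)) : S.card ≤ (n + 2) ^ 4 :=
  (Finset.card_le_univ S).trans (card_labels_le n)

/-- The path `q`, which is stored already, is entered into the lists and counts of its vertices. -/
theorem runs_registerPath (hW : (n + 2) ^ 5 ≤ W) {σ : State} {S : Finset (Label n)} {q : Label n}
    (hq : q ∉ S) (hnd : (labelPath A D q).Nodup) (h8 : σ.reg 8 = code q)
    (hrow : ∀ j (h : j < (labelPath A D q).length),
      σ.mem 2 (code q) j = ((labelPath A D q)[j] : ℕ))
    (h16 : σ.reg 16 = (labelPath A D q).length)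
    (hI : Index σ (through (labelPath A D) S)) (hC : Counts σ (through (labelPath A D) S)) :
    Runs A D W (.for 10 16 registerVertex) σ fun σ' t =>
      Index σ' (through (labelPath A D) (insert q S)) ∧
      Counts σ' (through (labelPath A D) (insert q S)) ∧
      t ≤ 6 * (labelPath A D q).length + 2 := by
  have hW1 := succ_pow_lt n
  have hW2 := lt_pow n
  have hlen := hnd.length_le_card
  rw [Fintype.card_fin] at hlen
  refine .for (I := fun k σ' τ =>
    Index σ' (throughAnd (labelPath A D) S q ((labelPath A D q).take k)) ∧
    Counts σ' (throughAnd (labelPath A D) S q ((labelPath A D q).take k)) ∧ τ ≤ 6 * k + 1)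
    (by decide) rfl rfl (by omega) ?_ ?_ ?_ ?_
  · rintro k σ τ v ⟨h1, h2, h3⟩
    exact ⟨h1.congr rfl rfl, h2.congr rfl, h3⟩
  · simp only [List.take_zero, throughAnd_nil]
    exact ⟨hI, hC, by omega⟩
  · rintro k σ₁ τ hk hF h10 ⟨h1, h2, h3⟩
    rw [h16] at hk
    have e8 := (hF.reg 8 rfl).trans h8
    have e2 : σ₁.mem 2 (code q) k = ((labelPath A D q)[k] : ℕ) := by
      rw [hF.mem 2 rfl]; exact hrow k hk
    set u := (labelPath A D q)[k] with hu
    have hnot : q ∉ throughAnd (labelPath A D) S q ((labelPath A D q).take k) u :=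
      not_mem_throughAnd hq (getElem_notMem_take hnd hk)
    have hlt := code_lt q
    have hun := u.2
    have hcard := card_lt_pow (throughAnd (labelPath A D) S q ((labelPath A D q).take k) u)
    have e6 := h1.card u
    have e5 := h2 u
    refine .seq (.assign ?_ (.seq (.store ?_ ?_ ?_ (.seq (.store ?_ ?_ ?_ (.store ?_ ?_ ?_ ?_))))))
      <;> simp [Expr.eval, e8, h10, e2, e6, e5]
    any_goals omega
    rw [throughAnd_eq_update (mem_take_succ_iff hk), ← hu]
    refine ⟨?_, ?_, by omega⟩
    · refine h1.insert hnot ?_ ?_ <;> intro v <;> by_cases hv : v = u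
      · subst hv; simp [e6]
      · simp [hv, Fin.val_inj]
      · subst hv; simp [e6]
      · simp [hv, Fin.val_inj]
    · intro v
      by_cases hv : v = u
      · subst hv
        rw [Function.update_self, Finset.card_insert_of_notMem hnot]
        simp
      · rw [Function.update_of_ne hv]
        simp [hv, Fin.val_inj, h2 v]
  · rintro σ' τ hF ⟨h1, h2, h3⟩
    rw [h16, List.take_length, throughAnd_path] at h1 h2
    rw [h16] at h3
    exact ⟨h1, h2, by omega⟩

theorem distWord_le (F : Option (Failure (Fin n))) (x y : Fin n) :
    distWord n (dist G F x y) ≤ n := by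
  rcases h : dist G F x y with _ | k
  · exact le_rfl
  · have := dist_lt_card h
    rw [Fintype.card_fin] at this
    exact this.le

theorem inRange_iff_distWord {F : Option (Failure (Fin n))} {x y : Fin n} {a b : ℝ} :
    InRange (dist G F x y) a b ↔ distWord n (dist G F x y) + 1 ≤ n ∧
      (distWord n (dist G F x y) : ℝ) ≤ b ∧ ¬ (distWord n (dist G F x y) : ℝ) ≤ a := by
  rcases h : dist G F x y with _ | k
  · simp only [distWord]
    constructor
    · rintro ⟨k, hk, -⟩
      exact absurd hk (ENat.top_ne_natCast k)
    · rintro ⟨h, -⟩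
      omega
  · have := dist_lt_card h
    rw [Fintype.card_fin] at this
    rw [show (some k : ℕ∞) = (k : ℕ∞) from rfl, inRange_iff_of_eq rfl]
    simp only [distWord, not_le]
    exact ⟨fun h => ⟨this, h.2, h.1⟩, fun h => ⟨h.2.2, h.2.1⟩⟩

theorem Stored.insert {σ σ' : State} {S : Finset (Label n)} {q : Label n}
    (h : Stored A D σ S S) (hnd : (labelPath A D q).Nodup)
    (h2 : ∀ q' j, σ'.mem 2 (code q') j = if q' = q then
      ((labelPath A D q).map Fin.val).getD j (σ.mem 2 (code q) j) else σ.mem 2 (code q') j)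
    (h3 : ∀ q', σ'.mem 3 (code q') 0 =
      if q' = q then (labelPath A D q).length else σ.mem 3 (code q') 0)
    (h4 : ∀ q', σ'.mem 4 (code q') 0 = if q' = q then 0 else σ.mem 4 (code q') 0) :
    Stored A D σ' (insert q S) (insert q S) := by
  refine ⟨subset_rfl, ?_, ?_, ?_, ?_, fun q' h h' => absurd h h'⟩
  · intro q' hq'
    rcases Finset.mem_insert.1 hq' with rfl | hq'
    exacts [hnd, h.nodup q' hq']
  · intro q' hq' j hj
    rw [h2]
    split_ifs with he
    · subst he
      simp [hj]
    · exact h.path q' ((Finset.mem_insert.1 hq').resolve_left he) j hj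
  · intro q' hq'
    rw [h3]
    split_ifs with he
    · rw [he]
    · exact h.length q' ((Finset.mem_insert.1 hq').resolve_left he)
  · intro q' hq'
    rw [h4]
    split_ifs with he
    · rfl
    · exact h.unhit q' ((Finset.mem_insert.1 hq').resolve_left he)

theorem code_inj {q q' : Label n} : code q = code q' ↔ q = q' := ⟨code_injective, fun h => h ▸ rfl⟩

/-- `M` bounds the number of vertices of the paths whose length is at most the value of the real
register `1`. -/
theorem runs_tryPath (hW : (n + 2) ^ 5 ≤ W) {σ : State} {S : Finset (Label n)} {x y : Fin n}
    {F : Option (Failure (Fin n))} {eF : Option (Failure Expr)} {M : ℕ} (hq : (x, y, F) ∉ S)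
    (h0 : σ.reg 0 = n) (h2 : σ.reg 2 = x) (h3 : σ.reg 3 = y)
    (hF : ∀ σ' : State, σ'.reg 6 = σ.reg 6 → σ'.reg 7 = σ.reg 7 →
      mapFailure (fun e => e.eval σ') eF = mapFailure Fin.val F)
    (hin : ∀ f ∈ F, f.IsIn G)
    (hsp : dist G F x y ≠ ⊤ → IsShortestPath G F x y (labelPath A D (x, y, F)))
    (hM : ∀ k : ℕ, (k : ℝ) ≤ σ.real 1 → k + 1 ≤ M) (hD : Data A D σ S S) :
    Runs A D W (tryPath eF) σ fun σ' t =>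
      (InRange (dist G F x y) (σ.real 2) (σ.real 1) →
        Data A D σ' (insert (x, y, F) S) (insert (x, y, F) S)) ∧
      (¬ InRange (dist G F x y) (σ.real 2) (σ.real 1) → Data A D σ' S S) ∧
      t ≤ 7 * M + 10 := by
  have hW1 := succ_pow_lt n
  have hW2 := lt_pow n
  have hlt := code_lt (x, y, F)
  have hdw := distWord_le (G := G) F x y
  have hcode : (Expr.eval σ (.add (.mul (.add (.mul (.reg 2) (.reg 0)) (.reg 3))
      (.add (.add (.const 1) (.reg 0)) (.mul (.reg 0) (.reg 0)))) (failureCodeExpr eF))) =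
      code (x, y, F) := by
    simp only [Expr.eval, failureCodeExpr_eval, hF σ rfl rfl, h0, h2, h3, code]
  unfold tryPath
  refine .seq (.assign (by rw [hcode]; omega) (.seq (.queryDist x y F ?_ ?_ ?_ hin (by omega) ?_)))
  · simp [Expr.eval, h2]
  · simp [Expr.eval, h3]
  · exact hF _ (by simp) (by simp)
  rw [hcode]
  set d := distWord n (dist G F x y) with hd
  refine .ite ?_ ?_
  · intro hb
    simp only [Cond.Holds, Expr.eval, State.setReg_reg, State.setReg_real] at hb
    norm_num [h0] at hb
    have hR : InRange (dist G F x y) (σ.real 2) (σ.real 1) := by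
      rw [inRange_iff_distWord, not_le]
      exact ⟨hb.1, hb.2.1, hb.2.2⟩
    obtain ⟨k, hk, -⟩ := id hR
    have hdk : d = k := by rw [hd, hk]; rfl
    have hsp := hsp (by simp [hk])
    have hlen := hsp.length_eq hk
    have hMk := hM d hb.2.1
    have hcard := card_lt_pow (insert (x, y, F) S)
    rw [Finset.card_insert_of_notMem hq] at hcard
    have hun := hD.unhit
    refine .seq (.queryPath x y F ?_ (by omega) ?_ ?_ ?_ hin (by simp [hk]) (.seq (.assign ?_
      (.seq (.store ?_ ?_ ?_ (.seq (.store ?_ ?_ ?_ (.seq (.assign ?_ ?_)))))))))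
    all_goals try simp [Expr.eval, h2, h3, hun]
    any_goals omega
    · exact hF _ (by simp) (by simp)
    refine (runs_registerPath (S := S) (A := A) (D := D) hW hq hsp.nodup (by simp) ?_ ?_ ?_
      ?_).mono ?_
    · intro j hj
      have hj' : j < (reported A D x y F).length := hj
      simp [labelPath, hj']
    · simp [hlen, hdk]
    · exact hD.index.congr (by ext; simp) (by ext; simp)
    · exact hD.counts.congr (by ext; simp)
    · rintro σ' t hFr ⟨hI, hC, ht⟩
      have hlen' : (reported A D x y F).length = k + 1 := hlen
      refine ⟨fun _ => ⟨(hD.stored.insert (σ' := σ') hsp.nodup ?_ ?_ ?_), hI, hC, ?_⟩,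
        fun h => absurd hR h, by omega⟩
      · intro q' j
        rw [hFr.mem 2 rfl]
        simp [code_inj, labelPath]
        split_ifs with he
        · rw [he]
        · rfl
      · intro q'
        rw [hFr.mem 3 rfl]
        simp [code_inj, hlen, hdk]
      · intro q'
        rw [hFr.mem 4 rfl]
        simp [code_inj]
      · rw [hFr.reg 12 rfl, Finset.card_insert_of_notMem hq]
        simp
  · intro hb
    refine .skip ⟨fun hR => absurd ?_ hb, fun _ => ?_, by omega⟩
    · rw [inRange_iff_distWord, not_le] at hR
      simp only [Cond.Holds, Expr.eval, State.setReg_reg, State.setReg_real]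
      norm_num [h0]
      exact ⟨hR.1, hR.2.1, hR.2.2⟩
    · exact ⟨hD.stored.congr rfl rfl rfl, hD.index.congr rfl rfl, hD.counts.congr rfl,
        by simpa using hD.unhit⟩

theorem Data.congr {σ σ' : State} {S R : Finset (Label n)} (h : Data A D σ S R)
    (h2 : σ'.mem 2 = σ.mem 2) (h3 : σ'.mem 3 = σ.mem 3) (h4 : σ'.mem 4 = σ.mem 4)
    (h5 : σ'.mem 5 = σ.mem 5) (h6 : σ'.mem 6 = σ.mem 6) (h7 : σ'.mem 7 = σ.mem 7)
    (h12 : σ'.reg 12 = σ.reg 12) : Data A D σ' S R :=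
  ⟨h.stored.congr h2 h3 h4, h.index.congr h6 h7, h.counts.congr h5, h12.trans h.unhit⟩

theorem Data.setReg {σ : State} {S R : Finset (Label n)} (h : Data A D σ S R) {r : ℕ}
    (hr : 12 ≠ r) (v : ℕ) : Data A D (σ.setReg r v) S R :=
  h.congr rfl rfl rfl rfl rfl rfl (by simp [hr])

open Classical in
/-- The labels in `S` that have been dealt with, `P` being the predicate that says so. -/
noncomputable def sel {ι : Type*} (S : Finset ι) (P : ι → Prop) : Finset ι := S.filter P

@[simp] theorem mem_sel {ι : Type*} {S : Finset ι} {P : ι → Prop} {q : ι} :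
    q ∈ sel S P ↔ q ∈ S ∧ P q := by
  simp [sel]

theorem sel_congr {ι : Type*} {S : Finset ι} {P P' : ι → Prop} (h : ∀ q ∈ S, P' q ↔ P q) :
    sel S P' = sel S P := by
  ext q
  simp only [mem_sel]
  exact and_congr_right fun hq => h q hq

/-- `runs_tryPath` in terms of the labels of the collection `S` that have been dealt with: before,
they are given by `P`, afterwards by `P'`. -/
theorem runs_tryPath_sel (hW : (n + 2) ^ 5 ≤ W) {σ : State} {S : Finset (Label n)} {x y : Fin n}
    {F : Option (Failure (Fin n))} {eF : Option (Failure Expr)} {M : ℕ} {P P' : Label n → Prop}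
    (hP : ¬ P (x, y, F)) (hP' : ∀ q, P' q ↔ P q ∨ q = (x, y, F))
    (hS : (x, y, F) ∈ S ↔ InRange (dist G F x y) (σ.real 2) (σ.real 1))
    (h0 : σ.reg 0 = n) (h2 : σ.reg 2 = x) (h3 : σ.reg 3 = y)
    (hF : ∀ σ' : State, σ'.reg 6 = σ.reg 6 → σ'.reg 7 = σ.reg 7 →
      mapFailure (fun e => e.eval σ') eF = mapFailure Fin.val F)
    (hin : ∀ f ∈ F, f.IsIn G)
    (hM : ∀ k : ℕ, (k : ℝ) ≤ σ.real 1 → k + 1 ≤ M) (hD : Data A D σ (sel S P) (sel S P)) :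
    Runs A D W (tryPath eF) σ fun σ' t => Data A D σ' (sel S P') (sel S P') ∧ t ≤ 7 * M + 10 := by
  have hsp : dist G F x y ≠ ⊤ → IsShortestPath G F x y (labelPath A D (x, y, F)) := by
    intro h
    cases F with
    | none => exact A.isShortestPath x y h
    | some f => exact D.isShortestPath x y f (hin f rfl) h
  refine (runs_tryPath hW (S := sel S P) (by simp [hP]) h0 h2 h3 hF hin hsp hM hD).mono ?_
  rintro σ' t - ⟨h1, h2, h3⟩
  refine ⟨?_, h3⟩
  by_cases hR : InRange (dist G F x y) (σ.real 2) (σ.real 1)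
  · convert h1 hR using 1 <;>
    · ext q
      simp only [mem_sel, Finset.mem_insert, hP']
      have := hS.2 hR
      constructor
      · rintro ⟨h1, h2 | rfl⟩ <;> tauto
      · rintro (rfl | h) <;> tauto
  · have he : sel S P' = sel S P := sel_congr fun q hq => by
      rw [hP']
      refine or_iff_left ?_
      rintro rfl
      exact hR (hS.1 hq)
    rw [he]
    exact h2 hR

/-- Row `j` of array `0` is the indicator vector of `B`. -/
def IsRow (σ : State) (j : ℕ) (B : Finset (Fin n)) : Prop :=
  ∀ v : Fin n, σ.mem 0 j v = if v ∈ B then 1 else 0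

theorem isRecent_holds_iff {σ : State} {B : ℕ → Finset (Fin n)} {i r : ℕ} {x : Fin n}
    (hi : 3 ≤ i) (h1 : σ.reg 1 = i) (hr : σ.reg r = x) (hB : ∀ j < i, IsRow σ j (B j)) :
    (isRecent r).Holds σ ↔ x ∈ recent B i := by
  simp only [isRecent, Cond.Holds, Expr.eval, h1, hr, hB (i - 3) (by omega) x,
    hB (i - 2) (by omega) x, hB (i - 1) (by omega) x, recent, Finset.mem_union]
  split_ifs <;> simp [*]

theorem onPath_inl_iff {p : List (Fin n)} {v : Fin n} :
    Failure.OnPath p (Sum.inl v) ↔ ∃ j < p.length, p[j]? = some v := by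
  rw [Failure.OnPath, List.mem_iff_getElem?]
  constructor
  · rintro ⟨j, hj⟩
    exact ⟨j, (List.getElem?_eq_some_iff.1 hj).1, hj⟩
  · rintro ⟨j, -, hj⟩
    exact ⟨j, hj⟩

theorem onPath_inr_iff {p : List (Fin n)} {u v : Fin n} :
    Failure.OnPath p (Sum.inr (u, v)) ↔
      ∃ j < p.length - 1, p[j]? = some u ∧ p[j + 1]? = some v := by
  rw [Failure.OnPath]
  constructor
  · rintro ⟨l₁, l₂, rfl⟩
    exact ⟨l₁.length, by simp, by simp, by simp⟩
  · rintro ⟨j, hj, h1, h2⟩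
    obtain ⟨hj1, h1⟩ := List.getElem?_eq_some_iff.1 h1
    obtain ⟨hj2, h2⟩ := List.getElem?_eq_some_iff.1 h2
    refine ⟨p.take j, p.drop (j + 2), ?_⟩
    rw [List.append_assoc]
    conv_rhs => rw [← List.take_append_drop j p, List.drop_eq_getElem_cons hj1,
      List.drop_eq_getElem_cons hj2, h1, h2]
    rfl

/-- The running time of `collectPair` for a pair of recent pivots, `M` being the largest number of
vertices of a path in the collection. -/
def pairCost (M : ℕ) : ℕ := 14 * M ^ 2 + 35 * M + 19

open Classical in
theorem runs_collectPair (hW : (n + 2) ^ 5 ≤ W) (hG : StronglyConnected G) {C : ℝ}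
    {σ : State} {B : ℕ → Finset (Fin n)} {i M : ℕ} {x y : Fin n} {P P' : Label n → Prop}
    (hP : ∀ q, P q → ¬ (q.1 = x ∧ q.2.1 = y))
    (hP' : ∀ q, P' q ↔ P q ∨ (q.1 = x ∧ q.2.1 = y))
    (hi : 3 ≤ i) (h0 : σ.reg 0 = n) (h1 : σ.reg 1 = i) (h2 : σ.reg 2 = x) (h3 : σ.reg 3 = y)
    (hr1 : σ.real 1 = C ^ (i + 1)) (hr2 : σ.real 2 = C ^ ((i : ℤ) - 6))
    (hB : ∀ j < i, IsRow σ j (B j))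
    (hM : ∀ k : ℕ, (k : ℝ) ≤ C ^ (i + 1) → k + 1 ≤ M)
    (hD : Data A D σ (sel (critical C A (recent B i) i) P)
      (sel (critical C A (recent B i) i) P)) :
    Runs A D W collectPair σ fun σ' t =>
      Data A D σ' (sel (critical C A (recent B i) i) P')
        (sel (critical C A (recent B i) i) P') ∧
      t ≤ if x ∈ recent B i ∧ y ∈ recent B i then pairCost M else 2 := by
  have hW1 := succ_pow_lt n
  have hW2 := lt_pow n
  set S := critical C A (recent B i) i with hS
  -- If no label of the pair is critical, nothing has to be done.
  have hnone (h : ∀ F, ¬ IsCritical C A (recent B i) i x y F) : sel S P' = sel S P := by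
    refine sel_congr fun q hq => ?_
    rw [hP']
    refine or_iff_left ?_
    rintro ⟨rfl, rfl⟩
    exact h q.2.2 (mem_critical.1 hq)
  unfold collectPair
  refine .ite ?_ ?_
  swap
  · intro hb
    simp only [Cond.Holds, isRecent_holds_iff hi h1 h2 hB, isRecent_holds_iff hi h1 h3 hB] at hb
    rw [hnone (by
      rintro (_ | f) h
      exacts [hb ⟨h.1, h.2.1⟩, hb ⟨h.1, h.2.1⟩]), if_neg hb]
    exact .skip ⟨hD, by omega⟩
  intro hb
  simp only [Cond.Holds, isRecent_holds_iff hi h1 h2 hB, isRecent_holds_iff hi h1 h3 hB] at hb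
  rw [if_pos hb]
  obtain ⟨d, hd⟩ := ENat.ne_top_iff_exists.1 (hG.dist_ne_top x y)
  have hsp := A.isShortestPath x y (by simp [← hd])
  have hlen := hsp.length_eq hd.symm
  have hdn := dist_lt_card hd.symm
  rw [Fintype.card_fin] at hdn
  have hdw : distWord n (dist G none x y) = d := by rw [← hd]; rfl
  refine .seq (.queryDist x y none (by simp [Expr.eval, h2]) (by simp [Expr.eval, h3]) rfl
    (by simp) (by omega) ?_)
  rw [hdw]
  refine .ite ?_ ?_
  swap
  · intro hb'
    simp [Cond.Holds, Expr.eval, hr1] at hb'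
    rw [hnone (by
      rintro (_ | f) h
      · have := ((inRange_iff_of_eq hd.symm).1 h.2.2).2
        linarith
      · obtain ⟨k, hk, hk'⟩ := h.2.2.1
        rw [← hd] at hk
        rw [← Nat.cast_inj.1 hk] at hk'
        linarith)]
    exact .skip ⟨hD.setReg (by decide) _, by unfold pairCost; omega⟩
  intro hb'
  simp only [Cond.Holds, Expr.eval, State.setReg_reg, State.setReg_real, if_true, hr1] at hb'
  have hMd := hM d hb'
  set p := A.path x y with hp
  -- The labels of the pair that have been dealt with after `k` vertices and `l` edges.
  let T : ℕ → ℕ → Label n → Prop := fun k l q => P q ∨ q = (x, y, none) ∨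
    (∃ j < k, ∃ v, p[j]? = some v ∧ q = (x, y, some (Sum.inl v))) ∨
    (∃ j < l, ∃ u v, p[j]? = some u ∧ p[j + 1]? = some v ∧ q = (x, y, some (Sum.inr (u, v))))
  have hcrit : ∀ f : Failure (Fin n), f.OnPath p → ((x, y, some f) ∈ S ↔
      InRange (dist G (some f) x y) (C ^ ((i : ℤ) - 6)) (C ^ (i + 1))) := by
    intro f hf
    rw [mem_critical]
    exact ⟨fun h => h.2.2.2.2, fun h => ⟨hb.1, hb.2, ⟨d, hd.symm, hb'⟩, hf, h⟩⟩
  have hT : ∀ q ∈ S, T (d + 1) d q ↔ P' q := by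
    rintro ⟨x', y', F⟩ hq
    rw [hP']
    simp only [T]
    constructor
    · rintro (h | h | ⟨j, -, v, -, h⟩ | ⟨j, -, u, v, -, -, h⟩)
      · exact .inl h
      all_goals
        right
        simp only [Prod.mk.injEq] at h
        exact ⟨h.1, h.2.1⟩
    · rintro (h | ⟨rfl, rfl⟩)
      · exact .inl h
      · right
        rcases F with _ | v | ⟨u, v⟩
        · exact .inl rfl
        · obtain ⟨j, hj, hv⟩ := onPath_inl_iff.1 (mem_critical.1 hq).2.2.2.1
          have hj : j < p.length := hj
          exact .inr (.inl ⟨j, by omega, v, hv, rfl⟩)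
        · obtain ⟨j, hj, hu, hv⟩ := onPath_inr_iff.1 (mem_critical.1 hq).2.2.2.1
          have hj : j < p.length - 1 := hj
          exact .inr (.inr ⟨j, by omega, u, v, hu, hv, rfl⟩)
  have hnd := hsp.nodup
  have hPT : ∀ F, ¬ P (x, y, F) := fun F h => hP _ h ⟨rfl, rfl⟩
  refine .seq ((runs_tryPath_sel (P := P) (P' := T 0 0) (F := none) (x := x) (y := y) hW (hPT _) ?_
    ?_ (by simp [h0]) (by simp [h2]) (by simp [h3]) (fun _ _ _ => rfl) (by simp)
    (by simpa [hr1] using hM) (hD.setReg (by decide) _)).mono ?_)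
  · intro q
    simp [T]
  · simp only [State.setReg_real, hr1, hr2]
    rw [mem_critical]
    exact ⟨fun h => h.2.2, fun h => ⟨hb.1, hb.2, h⟩⟩
  rintro σ₁ t₁ hF₁ ⟨hD₁, ht₁⟩
  have e0 : σ₁.reg 0 = n := by rw [hF₁.reg 0 rfl]; simp [h0]
  have e2 : σ₁.reg 2 = x := by rw [hF₁.reg 2 rfl]; simp [h2]
  have e3 : σ₁.reg 3 = y := by rw [hF₁.reg 3 rfl]; simp [h3]
  have e4 : σ₁.reg 4 = d := by rw [hF₁.reg 4 rfl]; simp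
  have er1 : σ₁.real 1 = C ^ (i + 1) := by rw [hF₁.real 1 rfl]; simp [hr1]
  have er2 : σ₁.real 2 = C ^ ((i : ℤ) - 6) := by rw [hF₁.real 2 rfl]; simp [hr2]
  have hlen' : (reported A D x y none).length = d + 1 := hlen
  refine .seq (.queryPath x y none (by simp only [Expr.eval]; omega) (by omega)
    (by simp [Expr.eval, e2]) (by simp [Expr.eval, e3]) rfl (by simp) (by simp [← hd])
    (.seq (.assign (by simp [Expr.eval, e4]; omega) (.seq ?_))))
  simp only [Expr.eval, State.setRow_reg, e4]
  set σ₂ := (σ₁.setRow 1 0 ((reported A D x y none).map Fin.val)).setReg 17 (d + 1) with hσ₂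
  have e17 : σ₂.reg 17 = d + 1 := by simp [hσ₂]
  have erow : ∀ (j : ℕ) (v : Fin n), p[j]? = some v → σ₂.mem 1 0 j = v := by
    intro j v hj
    simp [hσ₂, reported, ← hp, hj]
  refine .for (I := fun k σ' τ => Data A D σ' (sel S (T k 0)) (sel S (T k 0)) ∧
    τ ≤ k * (7 * M + 13) + 1) (by decide) rfl rfl (by omega) ?_ ?_ ?_ ?_
  · rintro k σ' τ v ⟨h, h'⟩
    exact ⟨h.setReg (by decide) _, h'⟩
  · exact ⟨(hD₁.congr (σ' := σ₁.setRow 1 0 ((reported A D x y none).map Fin.val)) (by ext; simp)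
      (by ext; simp) (by ext; simp) (by ext; simp) (by ext; simp) (by ext; simp) rfl).setReg
        (by decide) _, by omega⟩
  · rintro k σ₃ τ hk hF₃ e5 ⟨hD₃, hτ⟩
    rw [e17] at hk
    have hk' : k < p.length := by omega
    have erow3 : σ₃.mem 1 0 k = p[k] := by
      rw [hF₃.mem 1 rfl]
      exact erow k _ (List.getElem?_eq_getElem hk')
    have hlt := (p[k]).2
    refine .seq (.assign (by simp [Expr.eval, e5, erow3]; omega) ?_)
    have hon : Failure.OnPath p (Sum.inl p[k]) :=
      onPath_inl_iff.2 ⟨k, hk', List.getElem?_eq_getElem hk'⟩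
    refine (runs_tryPath_sel (P := T k 0) (P' := T (k + 1) 0) (F := some (Sum.inl p[k])) (x := x)
      (y := y) (M := M) hW ?_ ?_ ?_ ?_ ?_ ?_ ?_ ?_ ?_ (hD₃.setReg (by decide) _)).mono ?_
    · rintro (h | h | ⟨j, hj, v, hv, h⟩ | ⟨j, hj, -⟩)
      · exact hPT _ h
      · simp at h
      · simp only [Prod.mk.injEq, Option.some.injEq, Sum.inl.injEq, true_and] at h
        obtain ⟨hj', hv⟩ := List.getElem?_eq_some_iff.1 hv
        rw [← h] at hv
        have := (List.Nodup.getElem_inj_iff hnd).1 hv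
        omega
      · omega
    · intro q
      simp only [T]
      constructor
      · rintro (h | h | ⟨j, hj, v, hv, h⟩ | ⟨j, hj, -⟩)
        · exact .inl (.inl h)
        · exact .inl (.inr (.inl h))
        · rcases Nat.lt_succ_iff_lt_or_eq.1 hj with hj | rfl
          · exact .inl (.inr (.inr (.inl ⟨j, hj, v, hv, h⟩)))
          · right
            rw [List.getElem?_eq_getElem hk', Option.some.injEq] at hv
            rw [h, hv]
        · omega
      · rintro ((h | h | ⟨j, hj, v, hv, h⟩ | ⟨j, hj, -⟩) | h)
        · exact .inl h
        · exact .inr (.inl h)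
        · exact .inr (.inr (.inl ⟨j, by omega, v, hv, h⟩))
        · omega
        · exact .inr (.inr (.inl ⟨k, by omega, _, List.getElem?_eq_getElem hk', h⟩))
    · rw [hcrit _ hon, State.setReg_real, hF₃.real 1 rfl, hF₃.real 2 rfl]
      simp [hσ₂, er1, er2]
    · simp [hF₃.reg 0 rfl, hσ₂, e0]
    · simp [hF₃.reg 2 rfl, hσ₂, e2]
    · simp [hF₃.reg 3 rfl, hσ₂, e3]
    · intro σ' h6 _
      simp [mapFailure, Expr.eval, h6, e5, erow3]
    · intro f hf
      obtain rfl := Option.mem_some_iff.1 hf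
      exact hsp.1.isIn_of_onPath hon
    · rw [State.setReg_real, hF₃.real 1 rfl]
      simpa [hσ₂, er1] using hM
    · rintro σ' t - ⟨h, ht⟩
      refine ⟨h, ?_⟩
      rw [Nat.add_mul]; omega
  rintro σ₃ τ₃ hF₃ ⟨hD₃, hτ₃⟩
  rw [e17] at hD₃ hτ₃
  have f0 : σ₃.reg 0 = n := by rw [hF₃.reg 0 rfl]; simp [hσ₂, e0]
  have f2 : σ₃.reg 2 = x := by rw [hF₃.reg 2 rfl]; simp [hσ₂, e2]
  have f3 : σ₃.reg 3 = y := by rw [hF₃.reg 3 rfl]; simp [hσ₂, e3]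
  have f4 : σ₃.reg 4 = d := by rw [hF₃.reg 4 rfl]; simp [hσ₂, e4]
  have fr1 : σ₃.real 1 = C ^ (i + 1) := by rw [hF₃.real 1 rfl]; simp [hσ₂, er1]
  have fr2 : σ₃.real 2 = C ^ ((i : ℤ) - 6) := by rw [hF₃.real 2 rfl]; simp [hσ₂, er2]
  have frow : ∀ (j : ℕ) (v : Fin n), p[j]? = some v → σ₃.mem 1 0 j = v := by
    intro j v hj
    rw [hF₃.mem 1 rfl]
    exact erow j v hj
  refine .for (I := fun k σ' τ => Data A D σ' (sel S (T (d + 1) k)) (sel S (T (d + 1) k)) ∧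
    τ ≤ k * (7 * M + 14) + 1) (by decide) rfl rfl (by omega) ?_ ?_ ?_ ?_
  · rintro k σ' τ v ⟨h, h'⟩
    exact ⟨h.setReg (by decide) _, h'⟩
  · exact ⟨hD₃, by omega⟩
  · rintro k σ₄ τ hk hF₄ e5 ⟨hD₄, hτ⟩
    rw [f4] at hk
    have hk1 : k < p.length := by omega
    have hk2 : k + 1 < p.length := by omega
    have erow1 : σ₄.mem 1 0 k = p[k] := by
      rw [hF₄.mem 1 rfl]
      exact frow k _ (List.getElem?_eq_getElem hk1)
    have erow2 : σ₄.mem 1 0 (k + 1) = p[k + 1] := by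
      rw [hF₄.mem 1 rfl]
      exact frow (k + 1) _ (List.getElem?_eq_getElem hk2)
    have hlt1 := (p[k]).2
    have hlt2 := (p[k + 1]).2
    refine .seq (.assign (by simp [Expr.eval, e5, erow1]; omega)
      (.seq (.assign (by simp [Expr.eval, e5, erow2]; omega) ?_)))
    have hon : Failure.OnPath p (Sum.inr (p[k], p[k + 1])) :=
      onPath_inr_iff.2 ⟨k, by omega, List.getElem?_eq_getElem hk1, List.getElem?_eq_getElem hk2⟩
    refine (runs_tryPath_sel (P := T (d + 1) k) (P' := T (d + 1) (k + 1))
      (F := some (Sum.inr (p[k], p[k + 1]))) (x := x) (y := y) (M := M) hW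
      ?_ ?_ ?_ ?_ ?_ ?_ ?_ ?_ ?_ ((hD₄.setReg (by decide) _).setReg (by decide) _)).mono ?_
    · rintro (h | h | ⟨j, hj, v, hv, h⟩ | ⟨j, hj, u, v, hu, hv, h⟩)
      · exact hPT _ h
      · simp at h
      · simp at h
      · simp only [Prod.mk.injEq, Option.some.injEq, Sum.inr.injEq, true_and] at h
        obtain ⟨hj', hu⟩ := List.getElem?_eq_some_iff.1 hu
        rw [← h.1] at hu
        have := (List.Nodup.getElem_inj_iff hnd).1 hu
        omega
    · intro q
      simp only [T]
      constructor
      · rintro (h | h | h | ⟨j, hj, u, v, hu, hv, h⟩)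
        · exact .inl (.inl h)
        · exact .inl (.inr (.inl h))
        · exact .inl (.inr (.inr (.inl h)))
        · rcases Nat.lt_succ_iff_lt_or_eq.1 hj with hj | rfl
          · exact .inl (.inr (.inr (.inr ⟨j, hj, u, v, hu, hv, h⟩)))
          · right
            rw [List.getElem?_eq_getElem hk1, Option.some.injEq] at hu
            rw [List.getElem?_eq_getElem hk2, Option.some.injEq] at hv
            rw [h, hu, hv]
      · rintro ((h | h | h | ⟨j, hj, u, v, hu, hv, h⟩) | h)
        · exact .inl h
        · exact .inr (.inl h)
        · exact .inr (.inr (.inl h))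
        · exact .inr (.inr (.inr ⟨j, by omega, u, v, hu, hv, h⟩))
        · exact .inr (.inr (.inr ⟨k, by omega, _, _, List.getElem?_eq_getElem hk1,
            List.getElem?_eq_getElem hk2, h⟩))
    · rw [hcrit _ hon, State.setReg_real, State.setReg_real, hF₄.real 1 rfl, hF₄.real 2 rfl,
        fr1, fr2]
    · simp [hF₄.reg 0 rfl, f0]
    · simp [hF₄.reg 2 rfl, f2]
    · simp [hF₄.reg 3 rfl, f3]
    · intro σ' h6 h7
      simp [mapFailure, Expr.eval, h6, h7, e5, erow1, erow2]
    · intro f hf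
      obtain rfl := Option.mem_some_iff.1 hf
      exact hsp.1.isIn_of_onPath hon
    · rw [State.setReg_real, State.setReg_real, hF₄.real 1 rfl, fr1]
      exact hM
    · rintro σ' t - ⟨h, ht⟩
      refine ⟨h, ?_⟩
      rw [Nat.add_mul]; omega
  rintro σ' τ - ⟨h, hτ⟩
  rw [f4] at h hτ
  rw [sel_congr hT] at h
  refine ⟨h, ?_⟩
  have h1 : (d + 1) * (7 * M + 13) ≤ M * (7 * M + 13) := Nat.mul_le_mul_right _ hMd
  have h2 : d * (7 * M + 14) ≤ M * (7 * M + 14) := Nat.mul_le_mul_right _ (by omega)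
  rw [hlen']
  unfold pairCost
  nlinarith

theorem card_filter_lt_succ (X : Finset (Fin n)) (x : Fin n) :
    (X.filter fun v : Fin n => (v : ℕ) < x + 1).card =
      (X.filter fun v : Fin n => (v : ℕ) < x).card + if x ∈ X then 1 else 0 := by
  have h1 : X.filter (fun v : Fin n => (v : ℕ) < x + 1) =
      X.filter (fun v : Fin n => (v : ℕ) < x) ∪ X.filter (fun v : Fin n => v = x) := by
    ext v
    simp only [Finset.mem_union, Finset.mem_filter, Fin.ext_iff, ← and_or_left]
    exact and_congr_right fun _ => by omega
  rw [h1, Finset.card_union_of_disjoint, Finset.filter_eq']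
  · split_ifs <;> simp
  · rw [Finset.disjoint_filter]
    rintro v - h1 rfl
    omega

open Classical in
/-- The collection phase of a stage takes time `O(n ^ 2)` plus the cost for the pairs of recent
pivots. -/
theorem runs_collect (hW : (n + 2) ^ 5 ≤ W) (hG : StronglyConnected G) {C : ℝ}
    {σ : State} {B : ℕ → Finset (Fin n)} {i M : ℕ}
    (hi : 3 ≤ i) (h0 : σ.reg 0 = n) (h1 : σ.reg 1 = i)
    (hr1 : σ.real 1 = C ^ (i + 1)) (hr2 : σ.real 2 = C ^ ((i : ℤ) - 6))
    (hB : ∀ j < i, IsRow σ j (B j))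
    (hM : ∀ k : ℕ, (k : ℝ) ≤ C ^ (i + 1) → k + 1 ≤ M) (hD : Data A D σ ∅ ∅) :
    Runs A D W (.for 2 0 (.for 3 0 collectPair)) σ fun σ' t =>
      Data A D σ' (critical C A (recent B i) i) (critical C A (recent B i) i) ∧
      t ≤ n * (4 * n + 4) + 2 + pairCost M * (recent B i).card ^ 2 := by
  have hW1 := succ_pow_lt n
  have hW2 := lt_pow n
  set S := critical C A (recent B i) i with hS
  set X := recent B i with hX
  have hall : ∀ k, n ≤ k → (X.filter fun v : Fin n => (v : ℕ) < k) = X := fun k hk =>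
    Finset.filter_true_of_mem fun v _ => lt_of_lt_of_le v.2 hk
  refine .for (I := fun k σ' τ => Data A D σ' (sel S fun q => (q.1 : ℕ) < k)
      (sel S fun q => (q.1 : ℕ) < k) ∧
    τ ≤ k * (4 * n + 4) + 1 + pairCost M * (X.card * (X.filter fun v : Fin n => (v : ℕ) < k).card))
    (by decide) rfl rfl (by omega) ?_ ?_ ?_ ?_
  · rintro k σ' τ v ⟨h, h'⟩
    exact ⟨h.setReg (by decide) _, h'⟩
  · have : sel S (fun q => (q.1 : ℕ) < 0) = ∅ := by ext; simp
    rw [this]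
    exact ⟨hD, by omega⟩
  · rintro k σ₁ τ hk hF₁ e2 ⟨hD₁, hτ⟩
    rw [h0] at hk
    obtain ⟨x, rfl⟩ : ∃ x : Fin n, (x : ℕ) = k := ⟨⟨k, hk⟩, rfl⟩
    have f0 : σ₁.reg 0 = n := by rw [hF₁.reg 0 rfl, h0]
    refine .for (I := fun k σ' τ =>
      Data A D σ' (sel S fun q => (q.1 : ℕ) < x ∨ (q.1 = x ∧ (q.2.1 : ℕ) < k))
        (sel S fun q => (q.1 : ℕ) < x ∨ (q.1 = x ∧ (q.2.1 : ℕ) < k)) ∧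
      τ ≤ k * 4 + 1 + pairCost M *
        ((if x ∈ X then 1 else 0) * (X.filter fun v : Fin n => (v : ℕ) < k).card))
      (by decide) rfl rfl (by omega) ?_ ?_ ?_ ?_
    · rintro k σ' τ v ⟨h, h'⟩
      exact ⟨h.setReg (by decide) _, h'⟩
    · rw [sel_congr (P := fun q => (q.1 : ℕ) < x) (by simp)]
      exact ⟨hD₁, by omega⟩
    · rintro k σ₂ τ₂ hk hF₂ e3 ⟨hD₂, hτ₂⟩
      rw [f0] at hk
      obtain ⟨y, rfl⟩ : ∃ y : Fin n, (y : ℕ) = k := ⟨⟨k, hk⟩, rfl⟩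
      refine (runs_collectPair (C := C) (B := B) (i := i) (M := M) (x := x) (y := y)
        (P' := fun q => (q.1 : ℕ) < x ∨ (q.1 = x ∧ (q.2.1 : ℕ) < y + 1)) hW hG ?_ ?_ hi ?_ ?_ ?_ e3
        ?_ ?_ ?_ hM hD₂).mono ?_
      · rintro q (h | ⟨h, h'⟩) ⟨rfl, rfl⟩ <;> omega
      · intro q
        simp only [Fin.ext_iff]
        omega
      · rw [hF₂.reg 0 rfl, f0]
      · rw [hF₂.reg 1 rfl, hF₁.reg 1 rfl, h1]
      · rw [hF₂.reg 2 rfl, e2]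
      · rw [hF₂.real 1 rfl, hF₁.real 1 rfl, hr1]
      · rw [hF₂.real 2 rfl, hF₁.real 2 rfl, hr2]
      · intro j hj v
        rw [hF₂.mem 0 rfl, hF₁.mem 0 rfl]
        exact hB j hj v
      · rintro σ' t - ⟨h, ht⟩
        refine ⟨h, ?_⟩
        rw [card_filter_lt_succ]
        by_cases hx : x ∈ X <;> by_cases hy : y ∈ X <;>
          simp only [← hX, hx, hy, and_self, and_false, false_and, if_true, if_false, one_mul,
            zero_mul, mul_zero, add_zero, mul_add, mul_one] at ht hτ₂ ⊢ <;> omega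
    · rintro σ' τ' - ⟨h, hτ'⟩
      rw [f0] at h hτ'
      rw [hall n le_rfl] at hτ'
      rw [sel_congr (P := fun q => (q.1 : ℕ) < x + 1) (fun q _ => by
        have := q.2.1.2
        simp only [Fin.ext_iff]
        omega)] at h
      refine ⟨h, ?_⟩
      rw [card_filter_lt_succ, add_mul]
      by_cases hx : x ∈ X <;>
        simp only [hx, if_true, if_false, one_mul, zero_mul, mul_zero, add_zero, mul_add,
          mul_one] at hτ' hτ ⊢ <;> omega
  · rintro σ' τ - ⟨h, hτ⟩
    rw [h0] at h hτ
    rw [hall n le_rfl] at hτ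
    have : sel S (fun q => (q.1 : ℕ) < n) = S := by ext; simp
    rw [this] at h
    refine ⟨h, ?_⟩
    rw [sq]
    omega

end Collect

/-! ### The greedy selection on the machine -/

section Greedy

variable {n : ℕ} {G : Digraph (Fin n)} {A : APSPData G} {D : DSO G} {W : ℕ}

/-- Register `13` ends up with a vertex that is on the largest number of unhit paths. -/
theorem runs_findBest (hW : (n + 2) ^ 5 ≤ W) (hn : 0 < n) {σ : State} (h0 : σ.reg 0 = n) :
    Runs A D W findBest σ fun σ' t =>
      (∃ v : Fin n, σ'.reg 13 = v ∧ ∀ u : Fin n, σ.mem 5 u 0 ≤ σ.mem 5 v 0) ∧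
      t ≤ 4 * n + 3 := by
  have hW1 := succ_pow_lt n
  have hW2 := lt_pow n
  refine .seq (.assign (by simp only [Expr.eval]; omega) (.for
    (I := fun k σ' τ => (∃ v : Fin n, σ'.reg 13 = v ∧
      ∀ u : Fin n, (u : ℕ) < k → σ.mem 5 u 0 ≤ σ.mem 5 v 0) ∧ τ ≤ 4 * k + 1)
    (by decide) rfl rfl (by simp [h0]; omega) ?_ ?_ ?_ ?_))
  · rintro k σ' τ v ⟨⟨w, hw, h⟩, h'⟩
    exact ⟨⟨w, by simp [hw], h⟩, h'⟩
  · exact ⟨⟨⟨0, hn⟩, by simp [Expr.eval], by simp⟩, by omega⟩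
  · rintro k σ₁ τ hk hF e14 ⟨⟨w, hw, h⟩, h'⟩
    simp only [State.setReg_reg, h0] at hk
    norm_num at hk
    have e5 : σ₁.mem 5 = σ.mem 5 := hF.mem 5 rfl
    refine .ite (fun hb => .assign (by simp [Expr.eval, e14]; omega) ⟨⟨⟨k, hk⟩, ?_, ?_⟩, by omega⟩)
      (fun hb => .skip ⟨⟨w, hw, ?_⟩, by omega⟩)
    · simp [Expr.eval, e14]
    · simp only [Cond.Holds, Expr.eval, e5, e14, hw] at hb
      intro u hu
      rcases Nat.lt_succ_iff_lt_or_eq.1 hu with hu | hu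
      · have := h u hu
        show σ.mem 5 u 0 ≤ σ.mem 5 k 0
        omega
      · rw [hu]
    · simp only [Cond.Holds, Expr.eval, e5, e14, hw] at hb
      intro u hu
      rcases Nat.lt_succ_iff_lt_or_eq.1 hu with hu | hu
      · exact h u hu
      · rw [hu]; omega
  · rintro σ' τ - ⟨⟨w, hw, h⟩, h'⟩
    simp only [State.setReg_reg, h0] at h h'
    norm_num at h h'
    exact ⟨⟨w, hw, fun u => h u⟩, by omega⟩

/-- Undo the counts of the path `q`. -/
theorem runs_uncount (hW : (n + 2) ^ 5 ≤ W) {σ : State} {R : Finset (Label n)} {q : Label n}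
    (hq : q ∈ R) (hnd : (labelPath A D q).Nodup) (h8 : σ.reg 8 = code q)
    (hrow : ∀ j (h : j < (labelPath A D q).length),
      σ.mem 2 (code q) j = ((labelPath A D q)[j] : ℕ))
    (h16 : σ.reg 16 = (labelPath A D q).length)
    (hC : Counts σ (through (labelPath A D) R)) :
    Runs A D W (.for 10 16
        (.seq (.assign 11 (.load 2 (.reg 8) (.reg 10)))
          (.store 5 (.reg 11) (.const 0) (.sub (.load 5 (.reg 11) (.const 0)) (.const 1)))))
      σ fun σ' t =>
      Counts σ' (through (labelPath A D) (R.erase q)) ∧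
      t ≤ 4 * (labelPath A D q).length + 2 := by
  have hW1 := succ_pow_lt n
  have hW2 := lt_pow n
  have hlen := hnd.length_le_card
  rw [Fintype.card_fin] at hlen
  refine .for (I := fun k σ' τ =>
    Counts σ' (throughAnd (labelPath A D) (R.erase q) q ((labelPath A D q).drop k)) ∧
      τ ≤ 4 * k + 1) (by decide) rfl rfl (by omega) ?_ ?_ ?_ ?_
  · rintro k σ τ v ⟨h2, h3⟩
    exact ⟨h2.congr rfl, h3⟩
  · rw [List.drop_zero, throughAnd_path, Finset.insert_erase hq]
    exact ⟨hC, by omega⟩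
  · rintro k σ₁ τ hk hF h10 ⟨h2, h3⟩
    rw [h16] at hk
    have e8 := (hF.reg 8 rfl).trans h8
    have e2 : σ₁.mem 2 (code q) k = ((labelPath A D q)[k] : ℕ) := by
      rw [hF.mem 2 rfl]; exact hrow k hk
    set u := (labelPath A D q)[k] with hu
    have hnot : q ∉ throughAnd (labelPath A D) (R.erase q) q ((labelPath A D q).drop (k + 1)) u :=
      not_mem_throughAnd (Finset.notMem_erase q R) (getElem_notMem_drop hnd hk)
    have hun := u.2
    rw [throughAnd_eq_update (mem_drop_iff hk), ← hu] at h2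
    have e5 := h2 u
    rw [Function.update_self, Finset.card_insert_of_notMem hnot] at e5
    have hcard := card_lt_pow (throughAnd (labelPath A D) (R.erase q) q
      ((labelPath A D q).drop (k + 1)) u)
    refine .seq (.assign ?_ (.store ?_ ?_ ?_ ⟨fun v => ?_, by omega⟩)) <;>
      simp [Expr.eval, e8, h10, e2, e5]
    any_goals omega
    by_cases hv : v = u
    · subst hv
      simp
    · have := h2 v
      rw [Function.update_of_ne hv] at this
      simp [hv, Fin.val_inj, this]
  · rintro σ' τ - ⟨h2, h3⟩
    rw [h16, List.drop_length, throughAnd_nil] at h2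
    rw [h16] at h3
    exact ⟨h2, by omega⟩

variable (A D) in
/-- The time for marking the paths in `R` as hit. -/
def hitCost (R : Finset (Label n)) : ℕ := ∑ q ∈ R, (4 * (labelPath A D q).length + 7)

/-- One iteration over the list of the selected vertex, `q` being the listed path. -/
theorem runs_hitPath (hW : (n + 2) ^ 5 ≤ W) {σ : State} {S R : Finset (Label n)}
    (hD : Data A D σ S R) {q : Label n} (hq : q ∈ S)
    (hload : σ.mem 7 (σ.reg 13) (σ.reg 15) = code q) :
    Runs A D W hitPath σ fun σ' t =>
      Data A D σ' S (R.erase q) ∧ t + hitCost A D (R.erase q) ≤ 3 + hitCost A D R := by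
  have hW1 := succ_pow_lt n
  have hW2 := lt_pow n
  have hlt := code_lt q
  have hcard := card_lt_pow R
  have hnd := hD.stored.nodup q hq
  have hlen := hnd.length_le_card
  rw [Fintype.card_fin] at hlen
  refine .seq (.assign (by simp only [Expr.eval, hload]; omega) (.ite ?_ ?_))
  · intro hb
    simp only [Cond.Holds, Expr.eval, hload, State.setReg_reg, if_true, State.setReg_mem] at hb
    have hqR : q ∈ R := by
      by_contra h
      have := hD.stored.hit q hq h
      omega
    have hpos : 0 < R.card := Finset.card_pos.2 ⟨q, hqR⟩
    have hun := hD.unhit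
    have hl := hD.stored.length q hq
    refine .seq (.store ?_ ?_ ?_ (.seq (.assign ?_ (.seq (.assign ?_ ?_)))))
    all_goals try simp [Expr.eval, hload, hun, hl]
    any_goals omega
    refine (runs_uncount (A := A) (D := D) (R := R) (q := q) hW hqR hnd ?_ ?_ ?_ ?_).mono ?_
    · simp
    · intro j hj
      simp [hD.stored.path q hq j hj]
    · simp
    · exact hD.counts.congr (by ext; simp)
    · rintro σ' t hF ⟨hC, ht⟩
      have h2 : σ'.mem 2 = σ.mem 2 := by rw [hF.mem 2 rfl]; ext; simp
      have h3 : σ'.mem 3 = σ.mem 3 := by rw [hF.mem 3 rfl]; ext; simp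
      have h4 : ∀ q', σ'.mem 4 (code q') 0 = if q' = q then 1 else σ.mem 4 (code q') 0 := by
        intro q'
        rw [hF.mem 4 rfl]
        simp [code_inj]
      have hcost : hitCost A D (R.erase q) + (4 * (labelPath A D q).length + 7) =
          hitCost A D R :=
        Finset.sum_erase_add R (fun q => 4 * (labelPath A D q).length + 7) hqR
      refine ⟨⟨⟨(Finset.erase_subset q R).trans hD.stored.subset, hD.stored.nodup, ?_, ?_, ?_, ?_⟩,
        hD.index.congr ?_ ?_, hC, ?_⟩, by omega⟩
      · rw [h2]; exact hD.stored.path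
      · rw [h3]; exact hD.stored.length
      · intro q' hq'
        rw [h4, if_neg (Finset.ne_of_mem_erase hq')]
        exact hD.stored.unhit q' (Finset.mem_of_mem_erase hq')
      · intro q' hq' hn
        rw [h4]
        split_ifs with he
        · rfl
        · exact hD.stored.hit q' hq' fun h => hn (Finset.mem_erase.2 ⟨he, h⟩)
      · rw [hF.mem 6 rfl]; ext; simp
      · rw [hF.mem 7 rfl]; ext; simp
      · rw [hF.reg 12 rfl, Finset.card_erase_of_mem hqR]
        simp
  · intro hb
    simp only [Cond.Holds, Expr.eval, hload, State.setReg_reg, if_true, State.setReg_mem] at hb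
    have hqR : q ∉ R := fun h => hb (hD.stored.unhit q h).le
    rw [Finset.erase_eq_of_notMem hqR]
    exact .skip ⟨hD.setReg (by decide) _, by omega⟩

open Classical in
/-- The iteration over the list of the selected vertex `v` marks all paths through `v` as hit. -/
theorem runs_hitAll (hW : (n + 2) ^ 5 ≤ W) {σ : State} {S R : Finset (Label n)}
    (hD : Data A D σ S R) {v : Fin n} (h13 : σ.reg 13 = v)
    (h18 : σ.reg 18 = (through (labelPath A D) S v).card) :
    Runs A D W (.for 15 18 hitPath) σ fun σ' t =>
      Data A D σ' S (R.filter fun q => v ∉ labelPath A D q) ∧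
      t + hitCost A D (R.filter fun q => v ∉ labelPath A D q) ≤
        2 + 5 * (through (labelPath A D) S v).card + hitCost A D R := by
  have hW1 := succ_pow_lt n
  have hcard := card_lt_pow (through (labelPath A D) S v)
  refine .for (I := fun k σ' τ => Data A D σ' S (sel R fun q => ∀ j < k, σ.mem 7 v j ≠ code q) ∧
      τ + hitCost A D (sel R fun q => ∀ j < k, σ.mem 7 v j ≠ code q) ≤ 1 + 5 * k + hitCost A D R)
    (by decide) rfl rfl (by omega) ?_ ?_ ?_ ?_
  · rintro k σ' τ v ⟨h, h'⟩
    exact ⟨h.setReg (by decide) _, h'⟩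
  · have : sel R (fun q => ∀ j < 0, σ.mem 7 v j ≠ code q) = R := by ext; simp
    rw [this]
    exact ⟨hD, by omega⟩
  · rintro k σ₁ τ hk hF h15 ⟨h1, h2⟩
    rw [h18] at hk
    obtain ⟨q, hq, hqk⟩ := hD.index.sound v k hk
    refine (runs_hitPath hW h1 (mem_through.1 hq).1 ?_).mono ?_
    · rw [hF.mem 7 rfl, hF.reg 13 rfl, h15, h13, hqk]
    · rintro σ' t - ⟨h, ht⟩
      have he : (sel R fun q => ∀ j < k, σ.mem 7 v j ≠ code q).erase q =
          sel R fun q => ∀ j < k + 1, σ.mem 7 v j ≠ code q := by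
        ext q'
        simp only [Finset.mem_erase, mem_sel, Nat.forall_lt_succ_right, hqk, ne_eq, code_inj,
          eq_comm (a := q)]
        tauto
      rw [he] at h ht
      exact ⟨h, by omega⟩
  · rintro σ' τ - ⟨h, hτ⟩
    rw [h18] at h hτ
    have he : sel R (fun q => ∀ j < (through (labelPath A D) S v).card, σ.mem 7 v j ≠ code q) =
        R.filter fun q => v ∉ labelPath A D q := by
      ext q
      simp only [mem_sel, Finset.mem_filter]
      refine and_congr_right fun hq => ⟨fun h hv => ?_, fun h j hj he => ?_⟩
      · obtain ⟨k, hk, hk'⟩ := hD.index.complete v q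
          (mem_through.2 ⟨hD.stored.subset hq, hv⟩)
        exact h k hk hk'
      · obtain ⟨q', hq', he'⟩ := hD.index.sound v j hj
        rw [he, code_inj] at he'
        subst he'
        exact h (mem_through.1 hq').2
    rw [he] at h hτ
    exact ⟨h, by omega⟩

/-- The greedy phase. The time for a selected vertex is paid for by `n` and by the paths through it,
the time for the path that it hits by the length of this path. -/
theorem runs_greedy (hW : (n + 2) ^ 5 ≤ W) (hn : 0 < n) {σ : State} {S : Finset (Label n)} {i : ℕ}
    (hD : Data A D σ S S) (hne : ∀ q ∈ S, labelPath A D q ≠ [])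
    (h0 : σ.reg 0 = n) (h1 : σ.reg 1 = i) (hi : i < W) (hrow : IsRow (n := n) σ i ∅) :
    Runs A D W greedy σ fun σ' t => ∃ B : Finset (Fin n), GreedyRun (labelPath A D) S B ∧
      IsRow σ' i B ∧ (∀ j, j ≠ i → σ'.mem 0 j = σ.mem 0 j) ∧
      t ≤ n * (4 * n + 8) + 16 * ∑ q ∈ S, (labelPath A D q).length + 1 := by
  classical
  have hW1 := succ_pow_lt n
  have hW2 := lt_pow n
  set P := labelPath A D with hP
  -- A run is built from its end, so the invariant says that every run on the unhit paths `R`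
  -- extends the current selection `B` to a run on `S`. The unhit paths avoid `B`, so no vertex is
  -- selected twice and the lists of the selected vertices are paid for only once.
  refine .loop (I := fun μ σ' τ => ∃ (R : Finset (Label n)) (B : Finset (Fin n)), R.card = μ ∧
      Data A D σ' S R ∧ IsRow σ' i B ∧ (∀ j, j ≠ i → σ'.mem 0 j = σ.mem 0 j) ∧
      (∀ B', GreedyRun P R B' → GreedyRun P S (B ∪ B')) ∧
      (∀ v ∈ B, ∀ q ∈ R, v ∉ P q) ∧
      τ + hitCost A D R ≤ ∑ v ∈ B, (4 * n + 8 + 5 * (through P S v).card) + hitCost A D S)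
    (μ₀ := S.card) ?_ ?_ ?_
  · exact ⟨S, ∅, rfl, hD, hrow, fun _ _ => rfl, fun B' h => by simpa using h, by simp, by simp⟩
  · rintro μ σ₁ τ hF ⟨R, B, rfl, hD₁, hrow₁, hother, hrun, hB, hτ⟩ hb
    simp only [Cond.Holds, Expr.eval, hD₁.unhit] at hb
    have e0 : σ₁.reg 0 = n := (hF.reg 0 rfl).trans h0
    refine .seq ((runs_findBest hW hn e0).mono ?_)
    rintro σ₂ t₂ hF₂ ⟨⟨v, h13, hmax⟩, ht₂⟩
    have e1 : σ₂.reg 1 = i := by rw [hF₂.reg 1 rfl, hF.reg 1 rfl, h1]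
    have hvn := v.2
    have hcard := card_lt_pow (through P S v)
    have e6 : σ₂.mem 6 v 0 = (through P S v).card := by
      rw [hF₂.mem 6 rfl]; exact hD₁.index.card v
    have hD₂ : Data A D σ₂ S R := hD₁.congr (hF₂.mem 2 rfl) (hF₂.mem 3 rfl) (hF₂.mem 4 rfl)
      (hF₂.mem 5 rfl) (hF₂.mem 6 rfl) (hF₂.mem 7 rfl) (hF₂.reg 12 rfl)
    have e6' : (σ₂.setMem 0 i v 1).mem 6 v 0 = (through P S v).card := by simp [e6]
    have hD₂' : Data A D (σ₂.setMem 0 i v 1) S R :=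
      hD₂.congr (by ext; simp) (by ext; simp) (by ext; simp) (by ext; simp) (by ext; simp)
        (by ext; simp) rfl
    refine .seq (.store ?_ ?_ ?_ (.seq (.assign ?_ ?_))) <;>
      simp only [Expr.eval, e1, h13, State.setMem_reg, e6']
    any_goals omega
    refine (runs_hitAll (A := A) (D := D) (S := S) (R := R) (v := v) hW
      (hD₂'.setReg (by decide) _) (by simp [h13]) (by simp [hP])).mono ?_
    rintro σ₃ t₃ hF₃ ⟨hD₃, ht₃⟩
    have hmax' : ∀ u, (through P R u).card ≤ (through P R v).card := by
      intro u
      rw [← hD₁.counts u, ← hD₁.counts v]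
      exact hmax u
    -- A path is unhit, so the largest count is positive.
    obtain ⟨q, hq, hvq⟩ : ∃ q ∈ R, v ∈ P q := by
      obtain ⟨q, hq⟩ := Finset.card_pos.1 hb
      obtain ⟨u, hu⟩ := List.exists_mem_of_ne_nil _ (hne q (hD₁.stored.subset hq))
      have h1 : 0 < (through P R u).card := Finset.card_pos.2 ⟨q, mem_through.2 ⟨hq, hu⟩⟩
      obtain ⟨q', hq'⟩ := Finset.card_pos.1 (h1.trans_le (hmax' u))
      exact ⟨q', mem_through.1 hq'⟩
    have hvB : v ∉ B := fun h => hB v h q hq hvq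
    refine ⟨_, ?_, _, insert v B, rfl, hD₃, ?_, ?_, ?_, ?_, ?_⟩
    · refine Finset.card_lt_card (Finset.filter_ssubset.2 ⟨q, hq, ?_⟩)
      simpa using hvq
    · intro u
      rw [hF₃.mem 0 rfl, State.setReg_mem, State.setMem_mem, hF₂.mem 0 rfl, hrow₁ u]
      by_cases hu : u = v
      · simp [hu]
      · simp [hu, Fin.val_inj]
    · intro j hj
      rw [hF₃.mem 0 rfl, ← hother j hj, ← hF₂.mem 0 rfl]
      ext k
      simp [hj]
    · intro B' hB'
      rw [Finset.insert_union, ← Finset.union_insert]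
      refine hrun _ ?_
      convert GreedyRun.pick R v B' ⟨q, hq⟩ (fun u => hmax' u) (by convert hB')
    · intro u hu q hq
      rw [Finset.mem_filter] at hq
      rcases Finset.mem_insert.1 hu with rfl | hu
      · exact hq.2
      · exact hB u hu q hq.1
    · rw [show through (labelPath A D) S v = through P S v from rfl] at ht₃
      rw [Finset.sum_insert hvB]
      omega
  · rintro μ σ' τ hF ⟨R, B, rfl, hD₁, hrow₁, hother, hrun, hB, hτ⟩ hb
    simp only [Cond.Holds, Expr.eval, hD₁.unhit] at hb
    obtain rfl : R = ∅ := Finset.card_eq_zero.1 (by omega)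
    refine ⟨B, by simpa using hrun ∅ .done, hrow₁, hother, ?_⟩
    have h1 : ∑ v ∈ B, (4 * n + 8 + 5 * (through P S v).card) ≤
        n * (4 * n + 8) + 5 * ∑ q ∈ S, (P q).length := by
      calc _ ≤ ∑ v, (4 * n + 8 + 5 * (through P S v).card) :=
            Finset.sum_le_univ_sum_of_nonneg fun _ => Nat.zero_le _
        _ = _ := by
          rw [Finset.sum_add_distrib, ← Finset.mul_sum, sum_card_through hD.stored.nodup]
          simp [hP]
    have h2 : hitCost A D S ≤ 11 * ∑ q ∈ S, (P q).length := by
      unfold hitCost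
      rw [Finset.mul_sum]
      refine Finset.sum_le_sum fun q hq => ?_
      have : 0 < (labelPath A D q).length := List.length_pos_iff.2 (hne q hq)
      rw [hP]
      omega
    omega

end Greedy

/-! ### The stages -/

section Stage

variable {n : ℕ} {G : Digraph (Fin n)} {A : APSPData G} {D : DSO G} {W : ℕ} {C : ℝ}

/-- A pair of pivots contributes at most one path, and one for each vertex and each edge of
`P(x,y)`. -/
theorem card_critical_le {X : Finset (Fin n)} {i M : ℕ}
    (hM : ∀ k : ℕ, (k : ℝ) ≤ C ^ (i + 1) → k + 1 ≤ M) :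
    (critical C A X i).card ≤ 2 * M * X.card ^ 2 := by
  classical
  rw [sq, ← Finset.card_product]
  refine Finset.card_le_mul_card_image_of_maps_to (f := fun q => (q.1, q.2.1)) ?_ _ ?_
  · rintro ⟨x, y, F⟩ hq
    rw [mem_critical] at hq
    rcases F with _ | f
    · exact Finset.mem_product.2 ⟨hq.1, hq.2.1⟩
    · exact Finset.mem_product.2 ⟨hq.1, hq.2.1⟩
  · rintro ⟨x, y⟩ -
    by_cases hd : ∃ k : ℕ, dist G none x y = k ∧ (k : ℝ) ≤ C ^ (i + 1)
    · obtain ⟨k, hk, hkC⟩ := hd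
      set p := A.path x y with hp
      have hlen : p.length = k + 1 := (A.isShortestPath x y (by simp [hk])).length_eq hk
      have hsub : ((critical C A X i).filter fun q => (q.1, q.2.1) = (x, y)) ⊆
          (insert none (p.toFinset.image (fun v => some (Sum.inl v)) ∪
            (Finset.range (p.length - 1)).image
              (fun j => some (Sum.inr (p.getD j x, p.getD (j + 1) x))))).image
            fun F => (x, y, F) := by
        rintro ⟨x', y', F⟩ hq
        simp only [Finset.mem_filter, mem_critical, Prod.mk.injEq] at hq
        obtain ⟨hq, rfl, rfl⟩ := hq
        refine Finset.mem_image.2 ⟨F, ?_, rfl⟩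
        rcases F with _ | v | ⟨u, v⟩
        · simp
        · have : v ∈ p := hq.2.2.2.1
          simp [this]
        · obtain ⟨j, hj, h1, h2⟩ := onPath_inr_iff.1 hq.2.2.2.1
          refine Finset.mem_insert_of_mem (Finset.mem_union_right _ (Finset.mem_image.2
            ⟨j, Finset.mem_range.2 hj, ?_⟩))
          rw [List.getD_eq_getElem?_getD, List.getD_eq_getElem?_getD, hp, h1, h2]
          rfl
      refine (Finset.card_le_card hsub).trans (Finset.card_image_le.trans
        ((Finset.card_insert_le _ _).trans ?_))
      have h1 := Finset.card_union_le (p.toFinset.image (fun v =>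
        (some (Sum.inl v) : Option (Failure (Fin n))))) ((Finset.range (p.length - 1)).image
              (fun j => some (Sum.inr (p.getD j x, p.getD (j + 1) x))))
      have h2 := (Finset.card_image_le (s := p.toFinset) (f := fun v =>
        (some (Sum.inl v) : Option (Failure (Fin n))))).trans p.toFinset_card_le
      have h3 := Finset.card_image_le (s := Finset.range (p.length - 1))
        (f := fun j => (some (Sum.inr (p.getD j x, p.getD (j + 1) x)) : Option (Failure (Fin n))))
      rw [Finset.card_range] at h3
      have := hM k hkC
      omega
    · rw [Finset.filter_eq_empty_iff.2]
      · simp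
      · rintro ⟨x', y', F⟩ hq h
        rw [mem_critical] at hq
        simp only [Prod.mk.injEq] at h
        obtain ⟨rfl, rfl⟩ := h
        apply hd
        rcases F with _ | f
        · obtain ⟨k, hk, -, hkC⟩ := hq.2.2
          exact ⟨k, hk, hkC⟩
        · exact hq.2.2.1

theorem sum_length_critical_le {X : Finset (Fin n)} {i M : ℕ}
    (hM : ∀ k : ℕ, (k : ℝ) ≤ C ^ (i + 1) → k + 1 ≤ M) :
    ∑ q ∈ critical C A X i, (labelPath A D q).length ≤ 2 * M ^ 2 * X.card ^ 2 := by
  calc _ ≤ ∑ q ∈ critical C A X i, M := by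
        refine Finset.sum_le_sum fun q hq => ?_
        obtain ⟨hsp, k, hk, -, hkC⟩ := (mem_critical.1 hq).isShortestPath (D := D)
        have := hsp.length_eq hk
        have hMk := hM k hkC
        show (reported A D q.1 q.2.1 q.2.2).length ≤ M
        omega
    _ = (critical C A X i).card * M := by simp
    _ ≤ 2 * M * X.card ^ 2 * M := Nat.mul_le_mul_right _ (card_critical_le hM)
    _ = _ := by ring

/-- A stage clears the counts, the lists and its own row of pivots, so nothing is assumed about what
earlier stages have left there. -/
theorem runs_stage (hW : (n + 2) ^ 5 ≤ W) (hG : StronglyConnected G) (hn : 0 < n)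
    {σ : State} {B : ℕ → Finset (Fin n)} {i M : ℕ} (hi : 3 ≤ i) (hiW : i < W)
    (h0 : σ.reg 0 = n) (h1 : σ.reg 1 = i)
    (hr1 : σ.real 1 = C ^ (i + 1)) (hr2 : σ.real 2 = C ^ ((i : ℤ) - 6))
    (hB : ∀ j < i, IsRow σ j (B j))
    (hM : ∀ k : ℕ, (k : ℝ) ≤ C ^ (i + 1) → k + 1 ≤ M) (hM0 : 0 < M) :
    Runs A D W stage σ fun σ' t => ∃ Bi : Finset (Fin n),
      GreedyRun (labelPath A D) (critical C A (recent B i) i) Bi ∧ IsRow σ' i Bi ∧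
      (∀ j < i, IsRow σ' j (B j)) ∧ t ≤ 31 * n ^ 2 + 100 * (M * (recent B i).card) ^ 2 := by
  have hW1 := succ_pow_lt n
  have hW2 := lt_pow n
  refine .seq (.for (I := fun k σ' τ => (∀ v < k, σ'.mem 0 i v = 0 ∧ σ'.mem 5 v 0 = 0 ∧
      σ'.mem 6 v 0 = 0) ∧ (∀ j < i, IsRow σ' j (B j)) ∧ τ ≤ 5 * k + 1)
    (by decide) rfl rfl (by omega) ?_ ?_ ?_ ?_)
  · exact fun k σ' τ v h => h
  · exact ⟨by simp, hB, by omega⟩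
  · rintro k σ₁ τ hk hF h14 ⟨hc, hB₁, hτ⟩
    have e1 : σ₁.reg 1 = i := (hF.reg 1 rfl).trans h1
    refine .seq (.store ?_ ?_ ?_ (.seq (.store ?_ ?_ ?_ (.store ?_ ?_ ?_ ⟨?_, ?_, by omega⟩)))) <;>
      simp only [Expr.eval, State.setMem_reg, h14, e1]
    any_goals omega
    · intro v hv
      rcases Nat.lt_succ_iff_lt_or_eq.1 hv with hv | rfl
      · have := hc v hv
        simp [this]
      · simp
    · intro j hj v
      simp [hj.ne, hB₁ j hj v]
  rintro σ₁ τ₁ hF₁ ⟨hc, hB₁, hτ₁⟩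
  rw [h0] at hc hτ₁
  refine .seq (.assign (by simp only [Expr.eval]; omega) (.seq ?_))
  have hD : Data A D (σ₁.setReg 12 0) ∅ ∅ := by
    have hthrough : through (labelPath A D) ∅ = fun _ => ∅ := by ext; simp
    refine ⟨⟨subset_rfl, by simp, by simp, by simp, by simp, by simp⟩, ?_, ?_, by simp⟩
    · rw [hthrough]
      exact ⟨fun v => by simp [(hc v v.2).2.2], by simp, by simp⟩
    · rw [hthrough]
      intro v
      simp [(hc v v.2).2.1]
  refine (runs_collect (C := C) (B := B) (i := i) (M := M) hW hG hi ?_ ?_ ?_ ?_ ?_ hM hD).mono ?_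
  · simp [hF₁.reg 0 rfl, h0]
  · simp [hF₁.reg 1 rfl, h1]
  · simp [hF₁.real 1 rfl, hr1]
  · simp [hF₁.real 2 rfl, hr2]
  · exact hB₁
  rintro σ₂ t₂ hF₂ ⟨hD₂, ht₂⟩
  have em : σ₂.mem 0 = σ₁.mem 0 := hF₂.mem 0 rfl
  refine (runs_greedy (i := i) hW hn hD₂ ?_ ?_ ?_ hiW ?_).mono ?_
  · intro q hq
    obtain ⟨hsp, -⟩ := (mem_critical.1 hq).isShortestPath (D := D)
    obtain ⟨l, hl⟩ := hsp.1.exists_eq_cons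
    show reported A D q.1 q.2.1 q.2.2 ≠ []
    simp [hl]
  · rw [hF₂.reg 0 rfl]; simp [hF₁.reg 0 rfl, h0]
  · rw [hF₂.reg 1 rfl]; simp [hF₁.reg 1 rfl, h1]
  · intro v
    rw [em]
    simp [(hc v v.2).1]
  rintro σ₃ t₃ hF₃ ⟨Bi, hrun, hrow, hother, ht₃⟩
  refine ⟨Bi, hrun, hrow, fun j hj v => ?_, ?_⟩
  · rw [hother j hj.ne, em]
    exact hB₁ j hj v
  · have hsum := sum_length_critical_le (A := A) (D := D) (X := recent B i) hM
    have hpc : pairCost M ≤ 68 * M ^ 2 := by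
      unfold pairCost
      nlinarith
    have h1 := Nat.mul_le_mul_right ((recent B i).card ^ 2) hpc
    rw [mul_pow]
    have hnn : n ≤ n ^ 2 := by nlinarith
    have hn1 : 1 ≤ n ^ 2 := by nlinarith
    nlinarith

/-- The numbers of recent pivots and of vertices per path balance: a stage takes time
`O(n ^ 2 log ^ 2 n)`. -/
theorem stage_time_le (hC : 3 / 2 ≤ C) (hn : 0 < n) {B : ℕ → Finset (Fin n)} {i : ℕ} (hi3 : 3 ≤ i)
    (hi : i ≤ ceilLog C n) (hinit : ∀ j ≤ 2, B j = Finset.univ)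
    (hstep : ∀ j, 3 ≤ j → j < i →
      GreedyRun (labelPath A D) (critical C A (recent B j) j) (B j)) :
    31 * (n : ℝ) ^ 2 + 100 * (((⌊C ^ (i + 1)⌋₊ + 1 : ℕ) : ℝ) * (recent B i).card) ^ 2 ≤
      (31 + 3600 * (C ^ 2 + 4 * C ^ 6) ^ 2 * C ^ 8) * n ^ 2 * Real.log (n + 2) ^ 2 := by
  have hC0 : 0 < C := by linarith
  have hL := one_le_log_add_two hn
  set L := Real.log (n + 2) with hLdef
  set K := C ^ 2 + 4 * C ^ 6 with hK
  have hK0 : 0 < K := by positivity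
  have hsize : ∀ j, j < i → i ≤ j + 3 → ((B j).card : ℝ) ≤ K * (n / C ^ (i - 3)) * L := by
    intro j hj hj'
    refine (IsHDPHRun.card_le (D := D) hn hC (by omega) (fun h => hinit j h)
      (fun h => hstep j h hj)).trans ?_
    gcongr
    · linarith
    · omega
  have hX : ((recent B i).card : ℝ) ≤ 3 * (K * (n / C ^ (i - 3)) * L) := by
    have h1 : (recent B i).card ≤ (B (i - 3)).card + (B (i - 2)).card + (B (i - 1)).card := by
      classical
      unfold recent
      convert (Finset.card_union_le _ _).trans (Nat.add_le_add_right (Finset.card_union_le _ _) _)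
    have h2 : ((recent B i).card : ℝ) ≤ (B (i - 3)).card + (B (i - 2)).card + (B (i - 1)).card := by
      exact_mod_cast h1
    linarith [hsize (i - 3) (by omega) (by omega), hsize (i - 2) (by omega) (by omega),
      hsize (i - 1) (by omega) (by omega)]
  have hM : ((⌊C ^ (i + 1)⌋₊ + 1 : ℕ) : ℝ) ≤ 2 * C ^ (i + 1) := by
    push_cast
    have h1 := Nat.floor_le (show 0 ≤ C ^ (i + 1) by positivity)
    have h2 : 1 ≤ C ^ (i + 1) := one_le_pow₀ (by linarith)
    linarith
  have hprod : ((⌊C ^ (i + 1)⌋₊ + 1 : ℕ) : ℝ) * (recent B i).card ≤ 6 * K * C ^ 4 * n * L := by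
    calc _ ≤ 2 * C ^ (i + 1) * (3 * (K * (n / C ^ (i - 3)) * L)) := by gcongr
      _ = _ := by
        obtain ⟨m, rfl⟩ := Nat.exists_eq_add_of_le' hi3
        rw [show m + 3 + 1 = m + 4 by ring, show m + 3 - 3 = m by omega, pow_add]
        field_simp
        ring
  have hL2 : 1 ≤ L ^ 2 := one_le_pow₀ hL
  calc _ ≤ 31 * (n : ℝ) ^ 2 * L ^ 2 + 100 * (6 * K * C ^ 4 * n * L) ^ 2 := by
        exact add_le_add (le_mul_of_one_le_right (by positivity) hL2)
          (mul_le_mul_of_nonneg_left (pow_le_pow_left₀ (by positivity) hprod 2) (by norm_num))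
    _ = _ := by ring

theorem ceilLog_le (hC : 3 / 2 ≤ C) (hn : 0 < n) : (ceilLog C n : ℝ) ≤ 4 * Real.log (n + 2) := by
  have hL := one_le_log_add_two hn
  have hn' : (1 : ℝ) ≤ n := by exact_mod_cast hn
  have hlogC : 1 / 3 ≤ Real.log C := by
    have := Real.one_sub_inv_le_log_of_pos (show 0 < C by linarith)
    have h2 : C⁻¹ ≤ (3 / 2)⁻¹ := by gcongr
    norm_num at h2
    linarith
  have h0 : 0 ≤ Real.logb C n := Real.logb_nonneg (by linarith) hn'
  have h1 : (ceilLog C n : ℝ) < Real.logb C n + 1 := Nat.ceil_lt_add_one h0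
  have h2 : Real.logb C n ≤ 3 * Real.log (n + 2) := by
    rw [Real.logb, div_le_iff₀ (by linarith)]
    have : Real.log n ≤ Real.log (n + 2) := Real.log_le_log (by linarith) (by linarith)
    nlinarith
  linarith

theorem ceilLog_lt_pow (hC : 3 / 2 ≤ C) (hn : 0 < n) : ceilLog C n + 1 < (n + 2) ^ 4 := by
  have h1 := ceilLog_le hC hn
  have h2 := Real.log_le_sub_one_of_pos (show (0 : ℝ) < n + 2 by positivity)
  have h3 : (ceilLog C n : ℝ) ≤ 4 * (n + 1) := by linarith
  have h4 : ceilLog C n ≤ 4 * (n + 1) := by exact_mod_cast h3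
  nlinarith [Nat.zero_le n, Nat.zero_le (n ^ 2), Nat.zero_le (n ^ 3), Nat.zero_le (n ^ 4)]

end Stage

/-! ### The whole program -/

section Main

variable {n : ℕ} {G : Digraph (Fin n)} {A : APSPData G} {D : DSO G} {W : ℕ} {C : ℝ}

/-- The factor of `n ^ 2 * log (n + 2) ^ 2` in the running time of a stage. -/
noncomputable def stageFactor (C : ℝ) : ℝ := 31 + 3600 * (C ^ 2 + 4 * C ^ 6) ^ 2 * C ^ 8

theorem stageFactor_nonneg (C : ℝ) : 0 ≤ stageFactor C := by
  unfold stageFactor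
  positivity

variable (A D C) in
/-- The sets `B 0, …, B (i - 1)` are those of a run of the HDPH algorithm. -/
def PartialRun (i : ℕ) (B : ℕ → Finset (Fin n)) : Prop :=
  (∀ j ≤ 2, B j = Finset.univ) ∧
    ∀ j, 3 ≤ j → j < i → GreedyRun (labelPath A D) (critical C A (recent B j) j) (B j)

theorem PartialRun.update {i : ℕ} {B : ℕ → Finset (Fin n)} (h : PartialRun A D C i B) (hi : 3 ≤ i)
    {Bi : Finset (Fin n)}
    (hBi : GreedyRun (labelPath A D) (critical C A (recent B i) i) Bi) :
    PartialRun A D C (i + 1) (Function.update B i Bi) := by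
  have hne : ∀ j, j < i → Function.update B i Bi j = B j := fun j hj =>
    Function.update_of_ne hj.ne _ _
  have hrecent : ∀ j, 3 ≤ j → j ≤ i → recent (Function.update B i Bi) j = recent B j := by
    intro j hj3 hj
    simp only [recent, hne (j - 3) (by omega), hne (j - 2) (by omega), hne (j - 1) (by omega)]
  refine ⟨fun j hj => by rw [hne j (by omega), h.1 j hj], fun j hj3 hj => ?_⟩
  rw [hrecent j hj3 (by omega)]
  rcases Nat.lt_succ_iff_lt_or_eq.1 hj with hj | rfl
  · rw [hne j hj]
    exact h.2 j hj3 hj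
  · rw [Function.update_self]
    exact hBi

theorem runs_hdph (hC : 3 / 2 ≤ C) (hW : (n + 2) ^ 5 ≤ W) (hG : StronglyConnected G)
    (hn : 0 < n) :
    Runs A D W hdph (initial C n) fun σ t => ∃ B : ℕ → Finset (Fin n), IsHDPHRun C A D B ∧
      Outputs σ (ceilLog C n) B ∧
      (t : ℝ) ≤ (34 + 4 * stageFactor C) * n ^ 2 * Real.log (n + 2) ^ 3 := by
  have hW1 := succ_pow_lt n
  have hW2 := lt_pow n
  have hC0 : 0 < C := by linarith
  set ℓ := ceilLog C n with hℓ
  have hℓW : ℓ + 1 < (n + 2) ^ 4 := ceilLog_lt_pow hC hn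
  have hn' : (1 : ℝ) ≤ n := by exact_mod_cast hn
  have hL := one_le_log_add_two hn
  set L := Real.log (n + 2) with hLdef
  set T : ℝ := stageFactor C * n ^ 2 * L ^ 2 with hT
  have hT0 : 0 ≤ T := by
    have := stageFactor_nonneg C
    positivity
  refine .seq (.for (I := fun k σ' τ => (∀ v < k, ∀ j ≤ 2, σ'.mem 0 j v = 1) ∧ τ ≤ 5 * k + 1)
    (by decide) rfl rfl (by simp [initial]; omega) ?_ ?_ ?_ ?_)
  · exact fun k σ' τ v h => h
  · exact ⟨by simp, by omega⟩
  · rintro k σ₁ τ hk hF h14 ⟨hB₁, hτ⟩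
    simp only [initial, Function.update_self] at hk
    refine .seq (.store ?_ ?_ ?_ (.seq (.store ?_ ?_ ?_ (.store ?_ ?_ ?_ ⟨?_, by omega⟩)))) <;>
      simp only [Expr.eval, State.setMem_reg, h14]
    any_goals omega
    intro v hv j hj
    simp only [State.setMem_mem, true_and]
    rcases Nat.lt_succ_iff_lt_or_eq.1 hv with hv | rfl
    · simp [hv.ne, hB₁ v hv j hj]
    · interval_cases j <;> simp
  rintro σ₁ τ₁ hF₁ ⟨hB₁, hτ₁⟩
  have e0 : σ₁.reg 0 = n := by rw [hF₁.reg 0 rfl]; simp [initial]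
  have er0 : σ₁.real 0 = C := by rw [hF₁.real 0 rfl]; simp [initial]
  have hinit0 : (initial C n).reg 0 = n := by simp [initial]
  rw [hinit0] at hB₁ hτ₁
  refine .seq (.assign (by simp only [Expr.eval]; omega) (.seq (.realCast
    (by simp only [Expr.eval]; omega) (.seq (.realMul (.seq (.realMul (.seq (.realDiv
    (.seq (.realDiv ?_)))))))))))
  refine .loop (I := fun μ σ' τ => ∃ i, μ = ℓ + 1 - i ∧ 3 ≤ i ∧ (i ≤ ℓ + 1 ∨ i = 3) ∧
      σ'.reg 1 = i ∧ σ'.real 1 = C ^ (i + 1) ∧ σ'.real 2 = C ^ ((i : ℤ) - 6) ∧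
      σ'.real 3 = C ^ (i - 1) ∧ (τ : ℝ) ≤ (i - 3 : ℕ) * (T + 5) ∧
      ∃ B : ℕ → Finset (Fin n), (∀ j < i, IsRow σ' j (B j)) ∧ PartialRun A D C i B)
    (μ₀ := ℓ + 1 - 3) ?_ ?_ ?_
  · refine ⟨3, rfl, le_rfl, .inr rfl, by simp [Expr.eval], ?_, ?_, ?_, by simp,
      fun _ => Finset.univ, ?_, fun _ _ => rfl, by omega⟩
    · simp [er0]; ring
    · simp [er0, Expr.eval]
      field_simp
    · simp [er0]; ring
    · intro j hj v
      simp [hB₁ v v.2 j (by omega)]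
  · rintro μ σ₂ τ hF₂ ⟨i, rfl, hi3, hi, e1, er1, er2, er3, hτ, B, hB, hrun⟩ hb
    have f0 : σ₂.reg 0 = n := by rw [hF₂.reg 0 rfl]; simp [e0]
    have fr0 : σ₂.real 0 = C := by rw [hF₂.real 0 rfl]; simp [er0]
    simp only [Cond.Holds, Expr.eval, f0, er3, not_le] at hb
    have hiℓ : i ≤ ℓ := by
      have := (lt_of_lt_ceilLog (show 1 < C by linarith) hn).2 hb
      omega
    set M := ⌊C ^ (i + 1)⌋₊ + 1 with hM
    refine .seq ((runs_stage (M := M) hW hG hn hi3 (by omega) f0 e1 er1 er2 hB ?_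
      (by omega)).mono ?_)
    · intro k hk
      exact Nat.succ_le_succ (Nat.le_floor hk)
    rintro σ₃ t₃ hF₃ ⟨Bi, hBi, hrow, hB₃, ht₃⟩
    have g1 : σ₃.reg 1 = i := (hF₃.reg 1 rfl).trans e1
    have gr0 : σ₃.real 0 = C := (hF₃.real 0 rfl).trans fr0
    have gr1 : σ₃.real 1 = C ^ (i + 1) := (hF₃.real 1 rfl).trans er1
    have gr2 : σ₃.real 2 = C ^ ((i : ℤ) - 6) := (hF₃.real 2 rfl).trans er2
    have gr3 : σ₃.real 3 = C ^ (i - 1) := (hF₃.real 3 rfl).trans er3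
    refine .seq (.assign (by simp only [Expr.eval, g1]; omega) (.seq (.realMul (.seq (.realMul
      (.realMul ⟨ℓ + 1 - (i + 1), by omega, i + 1, rfl, by omega, .inl (by omega), ?_, ?_, ?_, ?_,
        ?_, Function.update B i Bi, ?_, hrun.update hi3 hBi⟩))))))
    · simp [Expr.eval, g1]
    · simp [gr0, gr1, pow_succ]
    · simp [gr0, gr2]
      rw [← zpow_add_one₀ hC0.ne']
      congr 1
      ring
    · simp [gr0, gr3]
      rw [← pow_succ]
      congr 1
      omega
    · have hstage := stage_time_le (A := A) (D := D) hC hn hi3 hiℓ hrun.1 hrun.2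
      have ht₃' : (t₃ : ℝ) ≤ T := by
        refine le_trans ?_ hstage
        exact_mod_cast ht₃
      rw [show i + 1 - 3 = (i - 3) + 1 by omega]
      push_cast
      linarith
    · intro j hj v
      rcases Nat.lt_succ_iff_lt_or_eq.1 hj with hj | rfl
      · rw [Function.update_of_ne hj.ne]
        exact hB₃ j hj v
      · rw [Function.update_self]
        exact hrow v
  · rintro μ σ₂ τ hF₂ ⟨i, rfl, hi3, hi, e1, er1, er2, er3, hτ, B, hB, hrun⟩ hb
    have f0 : σ₂.reg 0 = n := by rw [hF₂.reg 0 rfl]; simp [e0]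
    simp only [Cond.Holds, Expr.eval, f0, er3, not_not] at hb
    have hiℓ : ℓ < i := by
      by_contra h
      have := (lt_of_lt_ceilLog (i := i - 1) (show 1 < C by linarith) hn).1 (by omega)
      linarith
    refine ⟨B, ⟨hrun.1, fun j hj3 hj => ?_⟩, fun j hj v => ?_, ?_⟩
    · rw [Fintype.card_fin] at hj
      exact hrun.2 j hj3 (by omega)
    · rw [hB j (by omega) v]
    · have h1 : ((i - 3 : ℕ) : ℝ) ≤ 4 * L := by
        refine le_trans ?_ (ceilLog_le hC hn)
        exact_mod_cast (by omega : i - 3 ≤ ceilLog C n)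
      have h2 : (τ : ℝ) ≤ 4 * L * (T + 5) :=
        hτ.trans (mul_le_mul_of_nonneg_right h1 (by linarith))
      have h3 : (τ₁ : ℝ) ≤ 5 * n + 1 := by exact_mod_cast hτ₁
      have hn2 : (n : ℝ) ≤ n ^ 2 := by nlinarith
      have hL3 : L ≤ L ^ 3 := le_self_pow₀ hL (by norm_num)
      have h4 : (n : ℝ) ≤ n ^ 2 * L ^ 3 := by nlinarith
      have h5 : L ≤ n ^ 2 * L ^ 3 := by nlinarith
      have h6 : 4 * L * T = 4 * stageFactor C * n ^ 2 * L ^ 3 := by rw [hT]; ring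
      push_cast
      nlinarith

end Main

end HDPH

theorem mainTheorem7 :
    ∃ prog : HDPH.Cmd, ∀ C : ℝ, 3 / 2 ≤ C →
      ∃ (K : ℝ) (k w : ℕ), ∀ (n : ℕ) (G : Digraph (Fin n)), 0 < n → HDPH.StronglyConnected G →
        ∀ (A : HDPH.APSPData G) (D : HDPH.DSO G),
          -- the algorithm runs on words of `O(log n)` bits in time `Õ(n²)`
          (∃ (B : ℕ → Finset (Fin n)) (σ : HDPH.State) (t : ℕ),
            HDPH.IsHDPHRun C A D B ∧
            HDPH.Exec A D ((n + 2) ^ w) prog (HDPH.initial C n) σ t ∧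
            HDPH.Outputs σ (HDPH.ceilLog C n) B ∧
            (t : ℝ) ≤ K * (n : ℝ) ^ 2 * Real.log (n + 2) ^ k) ∧
          -- its sets are small and hit the paths, however ties are broken
          (∀ B : ℕ → Finset (Fin n), HDPH.IsHDPHRun C A D B → ∀ i ≤ HDPH.ceilLog C n,
            ((B i).card : ℝ) ≤ K * ((n : ℝ) / C ^ i) * Real.log (n + 2) ^ k ∧
            (∀ (s t : Fin n) (f : HDPH.Failure (Fin n)), f.IsIn G →
              HDPH.InRange (HDPH.dist G (some f) s t) (C ^ i) (C ^ (i + 1)) →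
              ∃ z ∈ B i, HDPH.dist G (some f) s t =
                HDPH.dist G (some f) s z + HDPH.dist G (some f) z t) ∧
            (∀ s t : Fin n,
              HDPH.InRange (HDPH.dist G none s t) (C ^ i) (C ^ (i + 1)) →
              ∃ z ∈ B i, HDPH.dist G none s t =
                HDPH.dist G none s z + HDPH.dist G none z t)) := by
  refine ⟨HDPH.hdph, fun C hC => ⟨(34 + 4 * HDPH.stageFactor C) + (C ^ 2 + 4 * C ^ 6), 3, 5,
    fun n G hn hG A D => ⟨?_, fun B hrun i hi => ?_⟩⟩⟩
  all_goals
    have hC0 : 0 < C := by linarith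
    have hL := HDPH.one_le_log_add_two hn
    have hL3 := pow_nonneg (zero_le_one.trans hL) 3
    have hs := HDPH.stageFactor_nonneg C
  · obtain ⟨σ, t, hexec, B, hrun, hout, ht⟩ :=
      HDPH.runs_hdph (A := A) (D := D) hC le_rfl hG hn
    exact ⟨B, σ, t, hrun, hexec, hout, ht.trans (mul_le_mul_of_nonneg_right
      (mul_le_mul_of_nonneg_right (le_add_of_nonneg_right (by positivity)) (by positivity)) hL3)⟩
  · have hi' : i ≤ HDPH.ceilLog C (Fintype.card (Fin n)) := by rwa [Fintype.card_fin]
    refine ⟨?_, fun s t f _ h => hrun.exists_pivot hC (some f) i hi' s t h,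
      fun s t h => hrun.exists_pivot hC none i hi' s t h⟩
    refine (HDPH.IsHDPHRun.card_le hn hC hi (fun h => hrun.init i h)
      (fun h => hrun.step i h hi')).trans ?_
    exact mul_le_mul (mul_le_mul_of_nonneg_right (le_add_of_nonneg_left (by positivity))
      (by positivity)) (le_self_pow₀ hL (by norm_num)) (zero_le_one.trans hL) (by positivity)
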